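/- All manifolds are smooth ($C^\infty$), finite-dimensional, Hausdorff and second countable. A Lie groupoid $\mathbb E=[E_1\rightrightarrows E_0]$ is a groupoid object in manifolds whose source and target maps are surjective submersions; $T\mathbb E=[TE_1\rightrightarrows TE_0]$ is its tangent groupoid, whose structure maps are the differentials of those of $\mathbb E$. A Lie $2$-group $\mathbb G=[G_1\rightrightarrows G_0]$ is a Lie groupoid such that $G_1,G_0$ are Lie groups and all structure maps are homomorphisms; $L(\mathbb G)=[L(G_1)\rightrightarrows L(G_0)]$ is the groupoid obtained by differentiating the structure maps at the identity. A principal $\mathbb G$-bundle over a Lie groupoid $\mathbb X$ is a smooth functor $\pi=(\pi_1,\pi_0)\colon\mathbb E\to\mathbb X$ together with a smooth functor $\mathbb E\times\mathbb G\to\mathbb E$ consisting of right actions of $G_i$ on $E_i$, such that $\pi_i\colon E_i\to X_i$ is a principal $G_i$-bundle for $i=0,1$. For such a bundle let $\mathrm{At}(E_i)=TE_i/G_i$ and $\mathrm{Ad}(E_i)=(E_i\times L(G_i))/G_i$ (the action being $(p,B)g=(pg,\mathrm{ad}_{g^{-1}}B)$), which are vector bundles over $X_i$. They form VB-groupoids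 $\mathrm{At}(\mathbb E)=[\mathrm{At}(E_1)\rightrightarrows\mathrm{At}(E_0)]$ and $\mathrm{Ad}(\mathbb E)=[\mathrm{Ad}(E_1)\rightrightarrows\mathrm{Ad}(E_0)]$ over $\mathbb X$, with structure maps induced on classes by those of $T\mathbb E$, $\mathbb E$ and $L(\mathbb G)$. Let $j\colon\mathrm{Ad}(\mathbb E)\to\mathrm{At}(\mathbb E)$ be given by $[(p,B)]\mapsto[(p,\delta_p(B))]$, where $\delta_p$ is the differential at the identity of $g\mapsto pg$. A (strict) connection on the principal $\mathbb G$-bundle is a morphism of VB-groupoids $R=(R_1,R_0)\colon\mathrm{At}(\mathbb E)\to\mathrm{Ad}(\mathbb E)$ over $\mathbb X$ (that is, a functor such that each $R_i$ is a smooth vector bundle morphism covering the identity of $X_i$) with $R\circ j=1_{\mathrm{Ad}(\mathbb E)}$. **Statement.** Let $X$ be a manifold and let $[X\rightrightarrows X]$ be the discrete Lie groupoid on $X$ (all arrows are identities). Then, for every Lie $2$-group $\mathbb G$, every principal $\mathbb G$-bundle over $[X\rightrightarrows X]$ admits a strict connection. -/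

import Mathlib

open scoped Manifold ContDiff Topology

noncomputable section

namespace PrincipalTwo

/-! ### Lie groupoids -/

section Groupoid

/-- A Lie groupoid `[M₁ ⇉ M₀]`: a groupoid whose arrows and objects form smooth manifolds (modelled
on `V₁`, `V₀`), with smooth structure maps and with source and target surjective submersions.
`comp g f` is `g ∘ f`; it is meaningful only when `src g = tgt f`, and no axiom (and no definition
below) mentions its values elsewhere. Surjectivity of `src` and `tgt` follows from the existence of
units. Since the composable pairs form an embedded submanifold of `M₁ × M₁`, smoothness of the
composition is smoothness on that subset. -/
structure LieGroupoid
    (V₁ : Type*) [NormedAddCommGroup V₁] [NormedSpace ℝ V₁]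
    (M₁ : Type*) [TopologicalSpace M₁] [ChartedSpace V₁ M₁]
    (V₀ : Type*) [NormedAddCommGroup V₀] [NormedSpace ℝ V₀]
    (M₀ : Type*) [TopologicalSpace M₀] [ChartedSpace V₀ M₀] where
  src : M₁ → M₀
  tgt : M₁ → M₀
  unit : M₀ → M₁
  comp : M₁ → M₁ → M₁
  inv : M₁ → M₁
  src_unit : ∀ x, src (unit x) = x
  tgt_unit : ∀ x, tgt (unit x) = x
  src_comp : ∀ g f, src g = tgt f → src (comp g f) = src f
  tgt_comp : ∀ g f, src g = tgt f → tgt (comp g f) = tgt g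
  comp_assoc : ∀ h g f, src h = tgt g → src g = tgt f → comp (comp h g) f = comp h (comp g f)
  comp_unit : ∀ f, comp f (unit (src f)) = f
  unit_comp : ∀ f, comp (unit (tgt f)) f = f
  src_inv : ∀ f, src (inv f) = tgt f
  tgt_inv : ∀ f, tgt (inv f) = src f
  inv_comp : ∀ f, comp (inv f) f = unit (src f)
  comp_inv : ∀ f, comp f (inv f) = unit (tgt f)
  contMDiff_src : ContMDiff 𝓘(ℝ, V₁) 𝓘(ℝ, V₀) ∞ src
  contMDiff_tgt : ContMDiff 𝓘(ℝ, V₁) 𝓘(ℝ, V₀) ∞ tgt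
  contMDiff_unit : ContMDiff 𝓘(ℝ, V₀) 𝓘(ℝ, V₁) ∞ unit
  contMDiff_inv : ContMDiff 𝓘(ℝ, V₁) 𝓘(ℝ, V₁) ∞ inv
  contMDiffOn_comp : ContMDiffOn (𝓘(ℝ, V₁).prod 𝓘(ℝ, V₁)) 𝓘(ℝ, V₁) ∞
    (fun q : M₁ × M₁ => comp q.1 q.2) {q : M₁ × M₁ | src q.1 = tgt q.2}
  submersion_src : ∀ f, Function.Surjective (mfderiv 𝓘(ℝ, V₁) 𝓘(ℝ, V₀) src f)
  submersion_tgt : ∀ f, Function.Surjective (mfderiv 𝓘(ℝ, V₁) 𝓘(ℝ, V₀) tgt f)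

variable {V₁ : Type*} [NormedAddCommGroup V₁] [NormedSpace ℝ V₁]
  {M₁ : Type*} [TopologicalSpace M₁] [ChartedSpace V₁ M₁]
  {V₀ : Type*} [NormedAddCommGroup V₀] [NormedSpace ℝ V₀]
  {M₀ : Type*} [TopologicalSpace M₀] [ChartedSpace V₀ M₀]

/-- Composition in the tangent groupoid `[TM₁ ⇉ TM₀]`: `x` is the composite `x₂ ∘ x₁`. The two
tangent vectors are composable if `s_*(x₂) = t_*(x₁)`, and their composite is the image of
`(x₂, x₁)` under the differential `D` of the composition map of the groupoid. The composition map
lives on the submanifold of composable pairs, whose tangent space consists of the composable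
pairs of tangent vectors, so the value `D (x₂, x₁)` does not depend on the choice of `D`. -/
def LieGroupoid.IsTangentComp (𝔼 : LieGroupoid V₁ M₁ V₀ M₀)
    (x₂ x₁ x : TangentBundle 𝓘(ℝ, V₁) M₁) : Prop :=
  tangentMap 𝓘(ℝ, V₁) 𝓘(ℝ, V₀) 𝔼.src x₂ = tangentMap 𝓘(ℝ, V₁) 𝓘(ℝ, V₀) 𝔼.tgt x₁ ∧
  ∃ D : TangentSpace (𝓘(ℝ, V₁).prod 𝓘(ℝ, V₁)) (x₂.proj, x₁.proj) →L[ℝ]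
      TangentSpace 𝓘(ℝ, V₁) (𝔼.comp x₂.proj x₁.proj),
    HasMFDerivWithinAt (𝓘(ℝ, V₁).prod 𝓘(ℝ, V₁)) 𝓘(ℝ, V₁)
      (fun q : M₁ × M₁ => 𝔼.comp q.1 q.2) {q : M₁ × M₁ | 𝔼.src q.1 = 𝔼.tgt q.2}
      (x₂.proj, x₁.proj) D ∧
    x = ⟨𝔼.comp x₂.proj x₁.proj, D (x₂.snd, x₁.snd)⟩

variable (V₀ M₀) in
/-- The discrete Lie groupoid `[M₀ ⇉ M₀]`, which has only identity arrows. -/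
def LieGroupoid.discrete : LieGroupoid V₀ M₀ V₀ M₀ where
  src := id
  tgt := id
  unit := id
  comp := fun g _ => g
  inv := id
  src_unit _ := rfl
  tgt_unit _ := rfl
  src_comp _ _ h := h
  tgt_comp _ _ _ := rfl
  comp_assoc _ _ _ _ _ := rfl
  comp_unit _ := rfl
  unit_comp _ := rfl
  src_inv _ := rfl
  tgt_inv _ := rfl
  inv_comp _ := rfl
  comp_inv _ := rfl
  contMDiff_src := contMDiff_id
  contMDiff_tgt := contMDiff_id
  contMDiff_unit := contMDiff_id
  contMDiff_inv := contMDiff_id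
  contMDiffOn_comp := contMDiff_fst.contMDiffOn
  submersion_src f := by
    rw [mfderiv_id]
    exact Function.surjective_id
  submersion_tgt f := by
    rw [mfderiv_id]
    exact Function.surjective_id

end Groupoid

/-- A (strict) Lie 2-group `[G₁ ⇉ G₀]`: a Lie groupoid whose manifolds of arrows and objects are Lie
groups and all of whose structure maps are group homomorphisms, so that the multiplication is a
functor (`comp_mul` is the interchange law). -/
structure LieTwoGroup
    (V₁ : Type*) [NormedAddCommGroup V₁] [NormedSpace ℝ V₁]
    (G₁ : Type*) [TopologicalSpace G₁] [ChartedSpace V₁ G₁] [Group G₁] [LieGroup 𝓘(ℝ, V₁) ∞ G₁]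
    (V₀ : Type*) [NormedAddCommGroup V₀] [NormedSpace ℝ V₀]
    (G₀ : Type*) [TopologicalSpace G₀] [ChartedSpace V₀ G₀] [Group G₀] [LieGroup 𝓘(ℝ, V₀) ∞ G₀]
    extends LieGroupoid V₁ G₁ V₀ G₀ where
  src_mul : ∀ k l, src (k * l) = src k * src l
  tgt_mul : ∀ k l, tgt (k * l) = tgt k * tgt l
  unit_mul : ∀ g h, unit (g * h) = unit g * unit h
  inv_mul : ∀ k l, inv (k * l) = inv k * inv l
  comp_mul : ∀ k₂ k₁ l₂ l₁, src k₂ = tgt k₁ → src l₂ = tgt l₁ →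
    comp (k₂ * l₂) (k₁ * l₁) = comp k₂ k₁ * comp l₂ l₁

/-! ### Smooth actions and principal bundles -/

section Action

/-- A smooth right action of the Lie group `G` on the manifold `P`. -/
structure SmoothRightAction
    (V : Type*) [NormedAddCommGroup V] [NormedSpace ℝ V]
    (P : Type*) [TopologicalSpace P] [ChartedSpace V P]
    (W : Type*) [NormedAddCommGroup W] [NormedSpace ℝ W]
    (G : Type*) [TopologicalSpace G] [ChartedSpace W G] [Group G] where
  act : P → G → P
  act_one : ∀ p, act p 1 = p
  act_mul : ∀ p g h, act p (g * h) = act (act p g) h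
  contMDiff_act : ContMDiff (𝓘(ℝ, V).prod 𝓘(ℝ, W)) 𝓘(ℝ, V) ∞ (fun q : P × G => act q.1 q.2)

variable {V : Type*} [NormedAddCommGroup V] [NormedSpace ℝ V]
  {P : Type*} [TopologicalSpace P] [ChartedSpace V P]
  {W : Type*} [NormedAddCommGroup W] [NormedSpace ℝ W]
  {G : Type*} [TopologicalSpace G] [ChartedSpace W G] [Group G]
  {U : Type*} [NormedAddCommGroup U] [NormedSpace ℝ U]
  {M : Type*} [TopologicalSpace M] [ChartedSpace U M]
  {V' : Type*} [NormedAddCommGroup V'] [NormedSpace ℝ V']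
  {P' : Type*} [TopologicalSpace P'] [ChartedSpace V' P']
  {W' : Type*} [NormedAddCommGroup W'] [NormedSpace ℝ W']
  {G' : Type*} [TopologicalSpace G'] [ChartedSpace W' G'] [Group G']

/-- `π : P → M`, with the given right action of `G` on `P`, is a principal `G`-bundle: `π` is smooth
and invariant, and locally over `M` there are `G`-equivariant diffeomorphisms `π⁻¹(O) ≅ O × G`
over `O`. -/
structure IsPrincipalBundle (U : Type*) [NormedAddCommGroup U] [NormedSpace ℝ U]
    {M : Type*} [TopologicalSpace M] [ChartedSpace U M]
    (A : SmoothRightAction V P W G) (π : P → M) : Prop where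
  contMDiff_proj : ContMDiff 𝓘(ℝ, V) 𝓘(ℝ, U) ∞ π
  proj_act : ∀ p g, π (A.act p g) = π p
  locally_trivial : ∀ x : M, ∃ O : Set M, IsOpen O ∧ x ∈ O ∧
    ∃ e : OpenPartialHomeomorph P (M × G),
      e.source = π ⁻¹' O ∧ e.target = O ×ˢ Set.univ ∧
      ContMDiffOn 𝓘(ℝ, V) (𝓘(ℝ, U).prod 𝓘(ℝ, W)) ∞ e e.source ∧
      ContMDiffOn (𝓘(ℝ, U).prod 𝓘(ℝ, W)) 𝓘(ℝ, V) ∞ e.symm e.target ∧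
      (∀ p ∈ e.source, (e p).1 = π p) ∧
      (∀ p ∈ e.source, ∀ g : G, (e (A.act p g)).2 = (e p).2 * g)

variable (W) in
/-- The adjoint action `ad_g : L(G) → L(G)`, the differential at `1` of `h ↦ g h g⁻¹`. -/
def adjointAction (g : G) : GroupLieAlgebra 𝓘(ℝ, W) G →L[ℝ] GroupLieAlgebra 𝓘(ℝ, W) G :=
  mfderiv 𝓘(ℝ, W) 𝓘(ℝ, W) (fun h : G => g * h * g⁻¹) 1

variable (W W') in
/-- The map `L(G) → L(G')` induced by a smooth homomorphism: its differential at `1`. -/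
def lieAlgebraMap (φ : G →* G') : GroupLieAlgebra 𝓘(ℝ, W) G →L[ℝ] GroupLieAlgebra 𝓘(ℝ, W') G' :=
  mfderiv 𝓘(ℝ, W) 𝓘(ℝ, W') (fun h : G => φ h) 1

namespace SmoothRightAction

/-- `δ_p : L(G) → T_p P`, the differential at `1` of `g ↦ p g`; `δ_p(B)` is the value at `p` of the
fundamental vector field of `B`. -/
def fundamental (A : SmoothRightAction V P W G) (p : P) :
    GroupLieAlgebra 𝓘(ℝ, W) G →L[ℝ] TangentSpace 𝓘(ℝ, V) p :=
  mfderiv 𝓘(ℝ, W) 𝓘(ℝ, V) (fun g : G => A.act p g) 1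

/-- The Atiyah bundle `At(P) = TP / G`. -/
def At (A : SmoothRightAction V P W G) : Type _ :=
  Quot (fun x y : TangentBundle 𝓘(ℝ, V) P =>
    ∃ g : G, y = tangentMap 𝓘(ℝ, V) 𝓘(ℝ, V) (fun p => A.act p g) x)

/-- The adjoint bundle `Ad(P) = (P × L(G)) / G`, for the action
`(p, B) g = (p g, ad_{g⁻¹} B)`. -/
def Ad (A : SmoothRightAction V P W G) : Type _ :=
  Quot (fun x y : P × GroupLieAlgebra 𝓘(ℝ, W) G =>
    ∃ g : G, y = (A.act x.1 g, adjointAction W g⁻¹ x.2))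

/-- The class `[(p, v)]` in `At(P)`. -/
def At.mk (A : SmoothRightAction V P W G) (x : TangentBundle 𝓘(ℝ, V) P) : A.At := Quot.mk _ x

/-- The class `[(p, B)]` in `Ad(P)`. -/
def Ad.mk (A : SmoothRightAction V P W G) (p : P) (B : GroupLieAlgebra 𝓘(ℝ, W) G) : A.Ad :=
  Quot.mk _ (p, B)

/-- The projection `At(P) → M`, `[(p, v)] ↦ π(p)`. -/
def At.proj {A : SmoothRightAction V P W G} {π : P → M} (h : IsPrincipalBundle U A π) :
    A.At → M :=
  Quot.lift (fun x => π x.proj) (by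
    rintro x y ⟨g, rfl⟩
    exact (h.proj_act x.proj g).symm)

/-- The projection `Ad(P) → M`, `[(p, B)] ↦ π(p)`. -/
def Ad.proj {A : SmoothRightAction V P W G} {π : P → M} (h : IsPrincipalBundle U A π) :
    A.Ad → M :=
  Quot.lift (fun x => π x.1) (by
    rintro x y ⟨g, rfl⟩
    exact (h.proj_act x.1 g).symm)

theorem contMDiff_act_left (A : SmoothRightAction V P W G) (p : P) :
    ContMDiff 𝓘(ℝ, W) 𝓘(ℝ, V) ∞ (fun g : G => A.act p g) :=
  A.contMDiff_act.comp (contMDiff_const.prodMk contMDiff_id)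

theorem contMDiff_act_right (A : SmoothRightAction V P W G) (g : G) :
    ContMDiff 𝓘(ℝ, V) 𝓘(ℝ, V) ∞ (fun p : P => A.act p g) :=
  A.contMDiff_act.comp (contMDiff_id.prodMk contMDiff_const)

theorem fundamental_act [LieGroup 𝓘(ℝ, W) ∞ G] (A : SmoothRightAction V P W G) (p : P) (g : G)
    (B : GroupLieAlgebra 𝓘(ℝ, W) G) :
    (⟨A.act p g, A.fundamental (A.act p g) (adjointAction W g⁻¹ B)⟩ :
        TangentBundle 𝓘(ℝ, V) P) =
      tangentMap 𝓘(ℝ, V) 𝓘(ℝ, V) (fun p => A.act p g) ⟨p, A.fundamental p B⟩ := by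
  have hc : ContMDiff 𝓘(ℝ, W) 𝓘(ℝ, W) ∞ (fun h : G => g⁻¹ * h * g⁻¹⁻¹) :=
    (contMDiff_const.mul contMDiff_id).mul contMDiff_const
  have e1 : g⁻¹ * 1 * g⁻¹⁻¹ = (1 : G) := by group
  have d1 : MDifferentiableAt 𝓘(ℝ, W) 𝓘(ℝ, V) (fun h : G => A.act (A.act p g) h)
      (g⁻¹ * 1 * g⁻¹⁻¹) := (A.contMDiff_act_left (A.act p g)).mdifferentiableAt (by simp)
  have d2 : MDifferentiableAt 𝓘(ℝ, W) 𝓘(ℝ, W) (fun h : G => g⁻¹ * h * g⁻¹⁻¹) 1 :=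
    hc.mdifferentiableAt (by simp)
  have d3 : MDifferentiableAt 𝓘(ℝ, V) 𝓘(ℝ, V) (fun p => A.act p g) (A.act p 1) :=
    (A.contMDiff_act_right g).mdifferentiableAt (by simp)
  have d4 : MDifferentiableAt 𝓘(ℝ, W) 𝓘(ℝ, V) (fun h : G => A.act p h) 1 :=
    (A.contMDiff_act_left p).mdifferentiableAt (by simp)
  have c1 := mfderiv_comp (1 : G) d1 d2
  have c2 := mfderiv_comp (1 : G) d3 d4
  have hf : (fun h : G => A.act (A.act p g) h) ∘ (fun h : G => g⁻¹ * h * g⁻¹⁻¹) =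
      (fun p => A.act p g) ∘ (fun h : G => A.act p h) := by
    funext h
    simp only [Function.comp, ← A.act_mul]
    congr 1
    group
  rw [hf, c2, e1, A.act_one p] at c1
  have h := congrArg (fun L : W →L[ℝ] V => L B) c1
  exact congrArg (fun v : V => (⟨A.act p g, v⟩ : TangentBundle 𝓘(ℝ, V) P)) h.symm

/-- The map `j : Ad(P) → At(P)`, `[(p, B)] ↦ [(p, δ_p(B))]`. -/
def j [LieGroup 𝓘(ℝ, W) ∞ G] (A : SmoothRightAction V P W G) : A.Ad → A.At :=
  Quot.map (fun x => ⟨x.1, A.fundamental x.1 x.2⟩) (by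
    rintro x y ⟨g, rfl⟩
    exact ⟨g, A.fundamental_act x.1 g x.2⟩)

/-- A smooth map `f : P → P'` that is equivariant along a smooth homomorphism `φ : G → G'`. -/
structure EquivariantMap (A : SmoothRightAction V P W G) (A' : SmoothRightAction V' P' W' G') where
  toFun : P → P'
  hom : G →* G'
  contMDiff_toFun : ContMDiff 𝓘(ℝ, V) 𝓘(ℝ, V') ∞ toFun
  contMDiff_hom : ContMDiff 𝓘(ℝ, W) 𝓘(ℝ, W') ∞ hom
  map_act : ∀ p g, toFun (A.act p g) = A'.act (toFun p) (hom g)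

variable {A : SmoothRightAction V P W G} {A' : SmoothRightAction V' P' W' G'}

/-- The map `At(P) → At(P')`, `[(p, v)] ↦ [(f(p), f_*(v))]`. -/
def At.map [IsManifold 𝓘(ℝ, V) ∞ P] [IsManifold 𝓘(ℝ, V') ∞ P']
    (F : EquivariantMap A A') : A.At → A'.At :=
  Quot.map (tangentMap 𝓘(ℝ, V) 𝓘(ℝ, V') F.toFun) (by
    rintro x y ⟨g, rfl⟩
    refine ⟨F.hom g, ?_⟩
    have d1 : MDifferentiable 𝓘(ℝ, V) 𝓘(ℝ, V') F.toFun :=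
      F.contMDiff_toFun.mdifferentiable (by simp)
    have d2 : MDifferentiable 𝓘(ℝ, V) 𝓘(ℝ, V) (fun p => A.act p g) :=
      (A.contMDiff_act_right g).mdifferentiable (by simp)
    have d3 : MDifferentiable 𝓘(ℝ, V') 𝓘(ℝ, V') (fun p => A'.act p (F.hom g)) :=
      (A'.contMDiff_act_right (F.hom g)).mdifferentiable (by simp)
    have hf : F.toFun ∘ (fun p => A.act p g) = (fun p => A'.act p (F.hom g)) ∘ F.toFun := by
      funext p
      exact F.map_act p g
    have c1 := congrFun (tangentMap_comp d1 d2) x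
    have c2 := congrFun (tangentMap_comp d3 d1) x
    rw [hf, c2] at c1
    exact c1.symm)

theorem lieAlgebraMap_adjointAction [LieGroup 𝓘(ℝ, W) ∞ G] [LieGroup 𝓘(ℝ, W') ∞ G']
    (φ : G →* G') (hφ : ContMDiff 𝓘(ℝ, W) 𝓘(ℝ, W') ∞ φ) (g : G)
    (B : GroupLieAlgebra 𝓘(ℝ, W) G) :
    lieAlgebraMap W W' φ (adjointAction W g B) =
      adjointAction W' (φ g) (lieAlgebraMap W W' φ B) := by
  have hc : ContMDiff 𝓘(ℝ, W) 𝓘(ℝ, W) ∞ (fun h : G => g * h * g⁻¹) :=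
    (contMDiff_const.mul contMDiff_id).mul contMDiff_const
  have hc' : ContMDiff 𝓘(ℝ, W') 𝓘(ℝ, W') ∞ (fun h : G' => φ g * h * (φ g)⁻¹) :=
    (contMDiff_const.mul contMDiff_id).mul contMDiff_const
  have e1 : g * 1 * g⁻¹ = (1 : G) := by group
  have d1 : MDifferentiableAt 𝓘(ℝ, W) 𝓘(ℝ, W') (fun h : G => φ h) (g * 1 * g⁻¹) :=
    hφ.mdifferentiableAt (by simp)
  have d2 : MDifferentiableAt 𝓘(ℝ, W) 𝓘(ℝ, W) (fun h : G => g * h * g⁻¹) 1 :=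
    hc.mdifferentiableAt (by simp)
  have d3 : MDifferentiableAt 𝓘(ℝ, W') 𝓘(ℝ, W') (fun h : G' => φ g * h * (φ g)⁻¹) (φ 1) :=
    hc'.mdifferentiableAt (by simp)
  have d4 : MDifferentiableAt 𝓘(ℝ, W) 𝓘(ℝ, W') (fun h : G => φ h) 1 :=
    hφ.mdifferentiableAt (by simp)
  have c1 := mfderiv_comp (1 : G) d1 d2
  have c2 := mfderiv_comp (1 : G) d3 d4
  have hf : (fun h : G => φ h) ∘ (fun h : G => g * h * g⁻¹) =
      (fun h : G' => φ g * h * (φ g)⁻¹) ∘ (fun h : G => φ h) := by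
    funext h
    simp
  rw [hf, c2, e1, map_one] at c1
  exact (congrArg (fun L : W →L[ℝ] W' => L B) c1).symm

/-- The map `Ad(P) → Ad(P')`, `[(p, B)] ↦ [(f(p), φ_*(B))]`. -/
def Ad.map [LieGroup 𝓘(ℝ, W) ∞ G] [LieGroup 𝓘(ℝ, W') ∞ G']
    (F : EquivariantMap A A') : A.Ad → A'.Ad :=
  Quot.map (fun x => (F.toFun x.1, lieAlgebraMap W W' F.hom x.2)) (by
    rintro x y ⟨g, rfl⟩
    refine ⟨F.hom g, ?_⟩
    rw [← map_inv, ← lieAlgebraMap_adjointAction F.hom F.contMDiff_hom, F.map_act])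

/-- `R : At(P) → Ad(P)` is a morphism of smooth vector bundles over `M` (covering the identity).
The vector space structures on the fibres are `a [(p, v)] + [(p, w)] = [(p, a v + w)]` and
`a [(p, B)] + [(p, C)] = [(p, a B + C)]`. The manifolds `At(P)` and `Ad(P)` are the quotients of
`TP` and `P × L(G)` by surjective submersions, so smoothness of `R` means that the map
`TP → Ad(P)` it induces lifts, locally on `TP`, to smooth maps into `P × L(G)`. -/
structure IsVectorBundleMap [IsManifold 𝓘(ℝ, V) ∞ P] {π : P → M} (h : IsPrincipalBundle U A π)
    (R : A.At → A.Ad) : Prop where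
  proj_map : ∀ a, Ad.proj h (R a) = At.proj h a
  linear : ∀ (p : P) (c : ℝ) (v w : TangentSpace 𝓘(ℝ, V) p) (B C : GroupLieAlgebra 𝓘(ℝ, W) G),
    R (At.mk A ⟨p, v⟩) = Ad.mk A p B → R (At.mk A ⟨p, w⟩) = Ad.mk A p C →
      R (At.mk A ⟨p, c • v + w⟩) = Ad.mk A p (c • B + C)
  smooth : ∀ x : TangentBundle 𝓘(ℝ, V) P, ∃ O ∈ 𝓝 x,
    ∃ (f : TangentBundle 𝓘(ℝ, V) P → P) (b : TangentBundle 𝓘(ℝ, V) P → W),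
      ContMDiffOn 𝓘(ℝ, V).tangent 𝓘(ℝ, V) ∞ f O ∧
      ContMDiffOn 𝓘(ℝ, V).tangent 𝓘(ℝ, W) ∞ b O ∧
      ∀ y ∈ O, R (At.mk A y) = Ad.mk A (f y) (b y)

end SmoothRightAction

end Action

/-! ### Principal 2-bundles and their connections -/

section Bundle

variable {V₁ : Type*} [NormedAddCommGroup V₁] [NormedSpace ℝ V₁]
  {E₁ : Type*} [TopologicalSpace E₁] [ChartedSpace V₁ E₁]
  {V₀ : Type*} [NormedAddCommGroup V₀] [NormedSpace ℝ V₀]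
  {E₀ : Type*} [TopologicalSpace E₀] [ChartedSpace V₀ E₀]
  {W₁ : Type*} [NormedAddCommGroup W₁] [NormedSpace ℝ W₁]
  {G₁ : Type*} [TopologicalSpace G₁] [ChartedSpace W₁ G₁] [Group G₁] [LieGroup 𝓘(ℝ, W₁) ∞ G₁]
  {W₀ : Type*} [NormedAddCommGroup W₀] [NormedSpace ℝ W₀]
  {G₀ : Type*} [TopologicalSpace G₀] [ChartedSpace W₀ G₀] [Group G₀] [LieGroup 𝓘(ℝ, W₀) ∞ G₀]
  {U₁ : Type*} [NormedAddCommGroup U₁] [NormedSpace ℝ U₁]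
  {X₁ : Type*} [TopologicalSpace X₁] [ChartedSpace U₁ X₁]
  {U₀ : Type*} [NormedAddCommGroup U₀] [NormedSpace ℝ U₀]
  {X₀ : Type*} [TopologicalSpace X₀] [ChartedSpace U₀ X₀]

/-- The structure of a principal `𝔾`-bundle over the Lie groupoid `𝕏` on the Lie groupoid `𝔼`: a
morphism of Lie groupoids `π = (proj₁, proj₀) : 𝔼 → 𝕏` and an action `𝔼 × 𝔾 → 𝔼` of the Lie 2-group
`𝔾`, i.e. a morphism of Lie groupoids `(action₁, action₀)` consisting of Lie group actions, such
that both `proj₁` and `proj₀` are principal bundles. -/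
structure PrincipalTwoBundle (𝔾 : LieTwoGroup W₁ G₁ W₀ G₀) (𝔼 : LieGroupoid V₁ E₁ V₀ E₀)
    (𝕏 : LieGroupoid U₁ X₁ U₀ X₀) where
  proj₁ : E₁ → X₁
  proj₀ : E₀ → X₀
  src_proj : ∀ γ, 𝕏.src (proj₁ γ) = proj₀ (𝔼.src γ)
  tgt_proj : ∀ γ, 𝕏.tgt (proj₁ γ) = proj₀ (𝔼.tgt γ)
  proj_unit : ∀ p, proj₁ (𝔼.unit p) = 𝕏.unit (proj₀ p)
  proj_comp : ∀ γ₂ γ₁, 𝔼.src γ₂ = 𝔼.tgt γ₁ →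
    proj₁ (𝔼.comp γ₂ γ₁) = 𝕏.comp (proj₁ γ₂) (proj₁ γ₁)
  action₁ : SmoothRightAction V₁ E₁ W₁ G₁
  action₀ : SmoothRightAction V₀ E₀ W₀ G₀
  src_act : ∀ γ k, 𝔼.src (action₁.act γ k) = action₀.act (𝔼.src γ) (𝔾.src k)
  tgt_act : ∀ γ k, 𝔼.tgt (action₁.act γ k) = action₀.act (𝔼.tgt γ) (𝔾.tgt k)
  unit_act : ∀ p g, 𝔼.unit (action₀.act p g) = action₁.act (𝔼.unit p) (𝔾.unit g)
  comp_act : ∀ γ₂ γ₁ k₂ k₁, 𝔼.src γ₂ = 𝔼.tgt γ₁ → 𝔾.src k₂ = 𝔾.tgt k₁ →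
    action₁.act (𝔼.comp γ₂ γ₁) (𝔾.comp k₂ k₁) =
      𝔼.comp (action₁.act γ₂ k₂) (action₁.act γ₁ k₁)
  isPrincipalBundle₁ : IsPrincipalBundle U₁ action₁ proj₁
  isPrincipalBundle₀ : IsPrincipalBundle U₀ action₀ proj₀

namespace PrincipalTwoBundle

variable {𝔾 : LieTwoGroup W₁ G₁ W₀ G₀} {𝔼 : LieGroupoid V₁ E₁ V₀ E₀}
  {𝕏 : LieGroupoid U₁ X₁ U₀ X₀}

/-- The source map of `𝔼`, equivariant along the source homomorphism of `𝔾`. -/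
def srcMap (𝔓 : PrincipalTwoBundle 𝔾 𝔼 𝕏) :
    SmoothRightAction.EquivariantMap 𝔓.action₁ 𝔓.action₀ where
  toFun := 𝔼.src
  hom := MonoidHom.mk' 𝔾.src 𝔾.src_mul
  contMDiff_toFun := 𝔼.contMDiff_src
  contMDiff_hom := 𝔾.contMDiff_src
  map_act := 𝔓.src_act

/-- The target map of `𝔼`, equivariant along the target homomorphism of `𝔾`. -/
def tgtMap (𝔓 : PrincipalTwoBundle 𝔾 𝔼 𝕏) :
    SmoothRightAction.EquivariantMap 𝔓.action₁ 𝔓.action₀ where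
  toFun := 𝔼.tgt
  hom := MonoidHom.mk' 𝔾.tgt 𝔾.tgt_mul
  contMDiff_toFun := 𝔼.contMDiff_tgt
  contMDiff_hom := 𝔾.contMDiff_tgt
  map_act := 𝔓.tgt_act

/-- The unit map of `𝔼`, equivariant along the unit homomorphism of `𝔾`. -/
def unitMap (𝔓 : PrincipalTwoBundle 𝔾 𝔼 𝕏) :
    SmoothRightAction.EquivariantMap 𝔓.action₀ 𝔓.action₁ where
  toFun := 𝔼.unit
  hom := MonoidHom.mk' 𝔾.unit 𝔾.unit_mul
  contMDiff_toFun := 𝔼.contMDiff_unit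
  contMDiff_hom := 𝔾.contMDiff_unit
  map_act := 𝔓.unit_act

/-- Composition in the groupoid `At(𝔼) = [At(E₁) ⇉ At(E₀)]`: `a = a₂ ∘ a₁`, computed on
representatives that are composable in `T𝔼`. -/
def AtComp (𝔓 : PrincipalTwoBundle 𝔾 𝔼 𝕏) (a₂ a₁ a : 𝔓.action₁.At) : Prop :=
  ∃ x₂ x₁ x : TangentBundle 𝓘(ℝ, V₁) E₁, 𝔼.IsTangentComp x₂ x₁ x ∧
    a₂ = SmoothRightAction.At.mk 𝔓.action₁ x₂ ∧ a₁ = SmoothRightAction.At.mk 𝔓.action₁ x₁ ∧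
    a = SmoothRightAction.At.mk 𝔓.action₁ x

/-- Composition in the groupoid `Ad(𝔼) = [Ad(E₁) ⇉ Ad(E₀)]`: `a = a₂ ∘ a₁`, computed as
`[(γ₂, K₂)] ∘ [(γ₁, K₁)] = [(γ₂ ∘ γ₁, K₂ ∘ K₁)]` on representatives that are composable. Here
`K₂ ∘ K₁ = K` is composition in `L(𝔾) = [L(G₁) ⇉ L(G₀)]`, whose structure maps are the differentials
of those of `𝔾` at the identity, i.e. composition in `T𝔾` of tangent vectors at the identity. -/
def AdComp (𝔓 : PrincipalTwoBundle 𝔾 𝔼 𝕏) (a₂ a₁ a : 𝔓.action₁.Ad) : Prop :=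
  ∃ (γ₂ γ₁ : E₁) (K₂ K₁ K : GroupLieAlgebra 𝓘(ℝ, W₁) G₁),
    𝔼.src γ₂ = 𝔼.tgt γ₁ ∧ 𝔾.IsTangentComp ⟨1, K₂⟩ ⟨1, K₁⟩ ⟨1, K⟩ ∧
    a₂ = SmoothRightAction.Ad.mk 𝔓.action₁ γ₂ K₂ ∧ a₁ = SmoothRightAction.Ad.mk 𝔓.action₁ γ₁ K₁ ∧
    a = SmoothRightAction.Ad.mk 𝔓.action₁ (𝔼.comp γ₂ γ₁) K

variable [IsManifold 𝓘(ℝ, V₁) ∞ E₁] [IsManifold 𝓘(ℝ, V₀) ∞ E₀]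

open SmoothRightAction in
/-- `(R₁, R₀) : At(𝔼) → Ad(𝔼)` is a morphism of VB-groupoids over `𝕏`: a pair of morphisms of smooth
vector bundles over `X₁` and `X₀` that is a functor. -/
structure IsVBGroupoidMap (𝔓 : PrincipalTwoBundle 𝔾 𝔼 𝕏) (R₁ : 𝔓.action₁.At → 𝔓.action₁.Ad)
    (R₀ : 𝔓.action₀.At → 𝔓.action₀.Ad) : Prop where
  isVectorBundleMap₁ : IsVectorBundleMap 𝔓.isPrincipalBundle₁ R₁
  isVectorBundleMap₀ : IsVectorBundleMap 𝔓.isPrincipalBundle₀ R₀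
  map_src : ∀ a, Ad.map 𝔓.srcMap (R₁ a) = R₀ (At.map 𝔓.srcMap a)
  map_tgt : ∀ a, Ad.map 𝔓.tgtMap (R₁ a) = R₀ (At.map 𝔓.tgtMap a)
  map_unit : ∀ a, Ad.map 𝔓.unitMap (R₀ a) = R₁ (At.map 𝔓.unitMap a)
  map_comp : ∀ a₂ a₁ a, 𝔓.AtComp a₂ a₁ a → 𝔓.AdComp (R₁ a₂) (R₁ a₁) (R₁ a)

/-- `R = (R₁, R₀)` is a (strict) connection on the principal 2-bundle: a morphism of VB-groupoids
`R : At(𝔼) → Ad(𝔼)` over `𝕏` with `R ∘ j = 1`, i.e. a retraction of the Atiyah sequence. -/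
structure IsStrictConnection (𝔓 : PrincipalTwoBundle 𝔾 𝔼 𝕏) (R₁ : 𝔓.action₁.At → 𝔓.action₁.Ad)
    (R₀ : 𝔓.action₀.At → 𝔓.action₀.Ad) : Prop extends IsVBGroupoidMap 𝔓 R₁ R₀ where
  retraction₁ : ∀ a, R₁ (𝔓.action₁.j a) = a
  retraction₀ : ∀ a, R₀ (𝔓.action₀.j a) = a

end PrincipalTwoBundle

end Bundle

end PrincipalTwo

end

/-! Over a discrete base every arrow is an identity, so all structure maps of `𝔼` preserve the
underlying point of `X`. A local section `σ` of `E₀` therefore gives a local section `unit ∘ σ` of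
`E₁`, and this pair trivializes the 2-bundle compatibly with its groupoid structure
(`exists_gauge_mem`). Writing `p = σ(π p) · coord p`, the derivative at `q = p` of `(coord p)⁻¹ *
coord q` is the pullback of the Maurer–Cartan form, a flat connection form over the domain of the
gauge. Since `coord` intertwines the structure maps of `𝔼` and `𝔾`, these local forms commute with
source, target and unit (`lieAlgebraMap_form`) and are multiplicative (`form_comp`).

The local forms are glued by one partition of unity on `X`, used for arrows and objects alike.
Reproducing fundamental vectors is an affine condition; the remaining identities are linear, and
they survive averaging because the weights depend only on the point of `X` (`map_average`,
`average_comp`). The resulting global forms descend to `At → Ad` (`isStrictConnection_toMap`).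

The delicate point is composition, which is differentiable only along the composable pairs. In `𝔾`
it extends to the smooth map `compExt` on all pairs, so that composition in `L(𝔾)` extends to a
linear map. In `𝔼`, a local map onto composable pairs built from `moveSrc` replaces the derivative
within a subset by an ordinary one. -/

namespace PrincipalTwo

/-! ### Differentials in model coordinates, and smoothness of a derivative along the diagonal. -/

section Calculus

variable {V : Type*} [NormedAddCommGroup V] [NormedSpace ℝ V]
  {P : Type*} [TopologicalSpace P] [ChartedSpace V P]
  {W : Type*} [NormedAddCommGroup W] [NormedSpace ℝ W]
  {N : Type*} [TopologicalSpace N] [ChartedSpace W N]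
  {W' : Type*} [NormedAddCommGroup W'] [NormedSpace ℝ W']

/-- Tangent vectors with equal base points and equal model vectors are equal. -/
theorem tangentBundle_mk_congr {a b : N} {v w : W} (h : a = b) (h' : v = w) :
    (⟨a, v⟩ : TangentBundle 𝓘(ℝ, W) N) = ⟨b, w⟩ := by
  subst h h'
  rfl

/-- The chain rule, for differentials evaluated on a vector of the model space. -/
theorem mfderiv_comp_model {H₁ H₂ H₃ : Type*} [TopologicalSpace H₁] [TopologicalSpace H₂]
    [TopologicalSpace H₃] {I₁ : ModelWithCorners ℝ V H₁} {I₂ : ModelWithCorners ℝ W H₂}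
    {I₃ : ModelWithCorners ℝ W' H₃}
    {P : Type*} [TopologicalSpace P] [ChartedSpace H₁ P]
    {N : Type*} [TopologicalSpace N] [ChartedSpace H₂ N]
    {N' : Type*} [TopologicalSpace N'] [ChartedSpace H₃ N']
    {g : N → N'} {f : P → N} (p : P) {y : N} (hy : f p = y)
    (hg : MDifferentiableAt I₂ I₃ g y) (hf : MDifferentiableAt I₁ I₂ f p) (v : V) :
    (mfderiv I₁ I₃ (fun q => g (f q)) p : V →L[ℝ] W') v =
      (mfderiv I₂ I₃ g y : W →L[ℝ] W') ((mfderiv I₁ I₂ f p : V →L[ℝ] W) v) := by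
  subst hy
  exact congrArg (fun L : V →L[ℝ] W' => L v) (mfderiv_comp p hg hf)

/-- The differential of a map into a product, evaluated on a vector of the model space. -/
theorem mfderiv_prodMk_model {H₁ H₂ H₃ : Type*} [TopologicalSpace H₁] [TopologicalSpace H₂]
    [TopologicalSpace H₃] {I₁ : ModelWithCorners ℝ V H₁} {I₂ : ModelWithCorners ℝ W H₂}
    {I₃ : ModelWithCorners ℝ W' H₃}
    {P : Type*} [TopologicalSpace P] [ChartedSpace H₁ P]
    {N : Type*} [TopologicalSpace N] [ChartedSpace H₂ N]
    {N' : Type*} [TopologicalSpace N'] [ChartedSpace H₃ N']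
    {f : P → N} {g : P → N'} {p : P}
    (hf : MDifferentiableAt I₁ I₂ f p) (hg : MDifferentiableAt I₁ I₃ g p) (v : V) :
    (mfderiv I₁ (I₂.prod I₃) (fun q => (f q, g q)) p : V →L[ℝ] W × W') v =
      ((mfderiv I₁ I₂ f p : V →L[ℝ] W) v, (mfderiv I₁ I₃ g p : V →L[ℝ] W') v) :=
  congrArg (fun L : V →L[ℝ] W × W' => L v) (mfderiv_prodMk hf hg)

/-- If `f p p` does not depend on `p`, then `(p, v) ↦ d(f p)_p v` is a smooth vector-valued
function on the tangent bundle. -/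
theorem contMDiffAt_mfderiv_diagonal [IsManifold 𝓘(ℝ, V) ∞ P] [IsManifold 𝓘(ℝ, W) ∞ N]
    {f : P → P → N} {c : N} (hc : ∀ p, f p p = c) (x₀ : TangentBundle 𝓘(ℝ, V) P)
    (hf : ContMDiffAt (𝓘(ℝ, V).prod 𝓘(ℝ, V)) 𝓘(ℝ, W) ∞ (Function.uncurry f)
      (x₀.proj, x₀.proj)) :
    ContMDiffAt 𝓘(ℝ, V).tangent 𝓘(ℝ, W) ∞
      (fun x : TangentBundle 𝓘(ℝ, V) P =>
        (mfderiv 𝓘(ℝ, V) 𝓘(ℝ, W) (f x.proj) x.proj : V →L[ℝ] W) x.snd) x₀ := by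
  have hproj : ContMDiffAt 𝓘(ℝ, V).tangent 𝓘(ℝ, V) ∞
      (fun x : TangentBundle 𝓘(ℝ, V) P => x.proj) x₀ :=
    Bundle.contMDiffAt_proj (TangentSpace 𝓘(ℝ, V))
  have htriv : ContMDiffAt 𝓘(ℝ, V).tangent 𝓘(ℝ, V) ∞
      (fun x : TangentBundle 𝓘(ℝ, V) P =>
        (trivializationAt V (TangentSpace 𝓘(ℝ, V)) x₀.proj x).2) x₀ :=
    ((Bundle.contMDiffAt_totalSpace (IB := 𝓘(ℝ, V))).1 (contMDiffAt_id (x := x₀))).2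
  -- This gives smoothness of the derivative read in the tangent coordinates at `x₀`; what remains
  -- is to see that both changes of coordinates drop out.
  have h := ContMDiffAt.mfderiv_apply (m := ∞) (n := ∞) f id
    (fun x : TangentBundle 𝓘(ℝ, V) P => x.proj) _ hf contMDiffAt_id hproj htriv le_rfl
  refine h.congr_of_eventuallyEq ?_
  have hmem : ∀ᶠ x : TangentBundle 𝓘(ℝ, V) P in 𝓝 x₀,
      x.proj ∈ (chartAt V x₀.proj).source :=
    hproj.continuousAt.preimage_mem_nhds
      ((chartAt V x₀.proj).open_source.mem_nhds (mem_chart_source V x₀.proj))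
  filter_upwards [hmem] with x hx
  have hdiag : (fun p : P => f p (id p)) = fun _ => c := funext hc
  rw [hdiag]
  have key := inTangentCoordinates_eq (I := 𝓘(ℝ, V)) (I' := 𝓘(ℝ, W)) (id : P → P)
    (fun _ : P => c) (fun p => (mfderiv 𝓘(ℝ, V) 𝓘(ℝ, W) (f p) p : V →L[ℝ] W))
    (x₀ := x₀.proj) (x := x.proj) hx (mem_chart_source W c)
  refine Eq.trans ?_ (congrArg (fun L : V →L[ℝ] W =>
    L (trivializationAt V (TangentSpace 𝓘(ℝ, V)) x₀.proj x).2) key.symm)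
  -- On the target side the base point is always `c`, so the change of coordinates is from a chart
  -- to itself.
  refine Eq.trans ?_ ((tangentBundleCore 𝓘(ℝ, W) N).coordChange_self (achart W c) c
    (mem_chart_source W c) _).symm
  refine congrArg (mfderiv 𝓘(ℝ, V) 𝓘(ℝ, W) (f x.proj) x.proj : V →L[ℝ] W) ?_
  -- On the source side, the change back to the chart at `x.proj` undoes the trivialization at
  -- `x₀.proj`.
  have h2 := (tangentBundleCore 𝓘(ℝ, V) P).coordChange_comp (achart V x.proj)
    (achart V x₀.proj) (achart V x.proj) x.proj
    ⟨⟨mem_chart_source V x.proj, hx⟩, mem_chart_source V x.proj⟩ x.snd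
  exact (h2.trans ((tangentBundleCore 𝓘(ℝ, V) P).coordChange_self _ _
    (mem_chart_source V x.proj) _)).symm

end Calculus

/-! ### Local gauges of a principal bundle and their flat connection forms. -/

section Gauge

variable {V : Type*} [NormedAddCommGroup V] [NormedSpace ℝ V]
  {P : Type*} [TopologicalSpace P] [ChartedSpace V P]
  {W : Type*} [NormedAddCommGroup W] [NormedSpace ℝ W]
  {G : Type*} [TopologicalSpace G] [ChartedSpace W G] [Group G]
  {U : Type*} [NormedAddCommGroup U] [NormedSpace ℝ U]
  {M : Type*} [TopologicalSpace M] [ChartedSpace U M]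
  {V' : Type*} [NormedAddCommGroup V'] [NormedSpace ℝ V']
  {P' : Type*} [TopologicalSpace P'] [ChartedSpace V' P']
  {W' : Type*} [NormedAddCommGroup W'] [NormedSpace ℝ W']
  {G' : Type*} [TopologicalSpace G'] [ChartedSpace W' G'] [Group G']

/-- A local gauge: a smooth local section `sec` of `π` over the open set `dom`, with the smooth
map `coord` into the group such that `p = sec (π p) · coord p`. -/
structure LocalGauge (U : Type*) [NormedAddCommGroup U] [NormedSpace ℝ U]
    {M : Type*} [TopologicalSpace M] [ChartedSpace U M]
    (A : SmoothRightAction V P W G) (π : P → M) where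
  dom : Set M
  sec : M → P
  coord : P → G
  isOpen_dom : IsOpen dom
  contMDiffOn_sec : ContMDiffOn 𝓘(ℝ, U) 𝓘(ℝ, V) ∞ sec dom
  contMDiffOn_coord : ContMDiffOn 𝓘(ℝ, V) 𝓘(ℝ, W) ∞ coord (π ⁻¹' dom)
  proj_sec : ∀ x ∈ dom, π (sec x) = x
  coord_sec_act : ∀ x ∈ dom, ∀ g, coord (A.act (sec x) g) = g
  sec_act_coord : ∀ p, π p ∈ dom → A.act (sec (π p)) (coord p) = p

variable {A : SmoothRightAction V P W G} {π : P → M}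

/-- A smooth local section of a principal bundle is the section of a local gauge. -/
theorem IsPrincipalBundle.exists_localGauge [LieGroup 𝓘(ℝ, W) ∞ G]
    (h : IsPrincipalBundle U A π) {O : Set M} (hO : IsOpen O) {τ : M → P}
    (hτ : ContMDiffOn 𝓘(ℝ, U) 𝓘(ℝ, V) ∞ τ O) (hπτ : ∀ x ∈ O, π (τ x) = x) {x : M} (hx : x ∈ O) :
    ∃ s : LocalGauge U A π, x ∈ s.dom ∧ s.dom ⊆ O ∧ s.sec = τ := by
  obtain ⟨O', hO', hxO', e, hs, -, he, -, he1, he2⟩ := h.locally_trivial x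
  have hmem : ∀ x ∈ O ∩ O', τ x ∈ e.source := fun x hx => by
    rw [hs, Set.mem_preimage, hπτ x hx.1]; exact hx.2
  have hact : ∀ p ∈ e.source, ∀ g, A.act p g ∈ e.source := fun p hp g => by
    rw [hs, Set.mem_preimage, h.proj_act]; rwa [hs] at hp
  have hpmem : ∀ p, π p ∈ O ∩ O' → p ∈ e.source := fun p hp => by rw [hs]; exact hp.2
  have hsnd : ContMDiffOn 𝓘(ℝ, V) 𝓘(ℝ, W) ∞ (fun p => (e p).2) e.source :=
    contMDiff_snd.comp_contMDiffOn he
  -- Left division by the value on `τ` makes the group component of `e` equal to `1` along `τ`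
  -- without disturbing right equivariance.
  refine ⟨⟨O ∩ O', τ, fun p => (e (τ (π p))).2⁻¹ * (e p).2, hO.inter hO',
    hτ.mono Set.inter_subset_left, ?_, fun x hx => hπτ x hx.1, ?_, ?_⟩, ⟨hx, hxO'⟩,
    Set.inter_subset_left, rfl⟩
  · have h1 : ContMDiffOn 𝓘(ℝ, V) 𝓘(ℝ, V) ∞ (fun p => τ (π p)) (π ⁻¹' (O ∩ O')) :=
      hτ.comp h.contMDiff_proj.contMDiffOn fun p hp => hp.1
    exact (hsnd.comp h1 fun p hp => hmem _ hp).inv.mul (hsnd.mono hpmem)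
  · intro x hx g
    simp only [h.proj_act, hπτ x hx.1, he2 _ (hmem x hx), inv_mul_cancel_left]
  · intro p hp
    have hm := hmem _ hp
    refine e.injOn (hact _ hm _) (hpmem p hp) (Prod.ext ?_ ?_)
    · rw [he1 _ (hact _ hm _), he1 _ (hpmem p hp), h.proj_act, hπτ _ hp.1]
    · rw [he2 _ hm, mul_inv_cancel_left]

/-- A principal bundle has local gauges around every point. -/
theorem IsPrincipalBundle.exists_localGauge_mem [LieGroup 𝓘(ℝ, W) ∞ G]
    (h : IsPrincipalBundle U A π) (x : M) : ∃ s : LocalGauge U A π, x ∈ s.dom := by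
  obtain ⟨O, hO, hxO, e, hs, ht, -, he, he1, -⟩ := h.locally_trivial x
  have hm : ∀ x ∈ O, (x, (1 : G)) ∈ e.target := fun x hx => by rw [ht]; exact ⟨hx, trivial⟩
  have hτ : ContMDiffOn 𝓘(ℝ, U) 𝓘(ℝ, V) ∞ (fun x => e.symm (x, (1 : G))) O :=
    he.comp (contMDiff_id.prodMk contMDiff_const).contMDiffOn hm
  obtain ⟨s, hx, -⟩ := h.exists_localGauge hO hτ
    (fun x hx => by rw [← he1 _ (e.map_target (hm x hx)), e.right_inv (hm x hx)]) hxO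
  exact ⟨s, hx⟩

namespace LocalGauge

/-- The restriction of a local gauge to a smaller open set. -/
def restrict (s : LocalGauge U A π) (O : Set M) (hO : IsOpen O) (h : O ⊆ s.dom) :
    LocalGauge U A π where
  dom := O
  sec := s.sec
  coord := s.coord
  isOpen_dom := hO
  contMDiffOn_sec := s.contMDiffOn_sec.mono h
  contMDiffOn_coord := s.contMDiffOn_coord.mono (Set.preimage_mono h)
  proj_sec x hx := s.proj_sec x (h hx)
  coord_sec_act x hx := s.coord_sec_act x (h hx)
  sec_act_coord p hp := s.sec_act_coord p (h hp)

theorem coord_act (s : LocalGauge U A π) {p : P} (hp : π p ∈ s.dom) (g : G) :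
    s.coord (A.act p g) = s.coord p * g := by
  conv_lhs => rw [← s.sec_act_coord p hp, ← A.act_mul]
  exact s.coord_sec_act _ hp _

theorem isOpen_preimage (s : LocalGauge U A π) (h : IsPrincipalBundle U A π) :
    IsOpen (π ⁻¹' s.dom) :=
  s.isOpen_dom.preimage h.contMDiff_proj.continuous

theorem contMDiffAt_coord (s : LocalGauge U A π) (h : IsPrincipalBundle U A π) {p : P}
    (hp : π p ∈ s.dom) : ContMDiffAt 𝓘(ℝ, V) 𝓘(ℝ, W) ∞ s.coord p :=
  s.contMDiffOn_coord.contMDiffAt ((s.isOpen_preimage h).mem_nhds hp)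

/-- The coordinate of `q` relative to that of `p`. -/
def relCoord (s : LocalGauge U A π) (p q : P) : G := (s.coord p)⁻¹ * s.coord q

@[simp]
theorem relCoord_self (s : LocalGauge U A π) (p : P) : s.relCoord p p = 1 :=
  inv_mul_cancel _

theorem contMDiffAt_relCoord [LieGroup 𝓘(ℝ, W) ∞ G] (s : LocalGauge U A π)
    (h : IsPrincipalBundle U A π) (p : P) {q : P} (hq : π q ∈ s.dom) :
    ContMDiffAt 𝓘(ℝ, V) 𝓘(ℝ, W) ∞ (s.relCoord p) q :=
  contMDiffAt_const.mul (s.contMDiffAt_coord h hq)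

theorem mdifferentiableAt_relCoord [LieGroup 𝓘(ℝ, W) ∞ G] (s : LocalGauge U A π)
    (h : IsPrincipalBundle U A π) (p : P) {q : P} (hq : π q ∈ s.dom) :
    MDifferentiableAt 𝓘(ℝ, V) 𝓘(ℝ, W) (s.relCoord p) q :=
  (s.contMDiffAt_relCoord h p hq).mdifferentiableAt (by simp)

/-- The connection form of the flat connection for which `sec` is horizontal. -/
noncomputable def form (s : LocalGauge U A π) (p : P) : V →L[ℝ] W :=
  mfderiv 𝓘(ℝ, V) 𝓘(ℝ, W) (s.relCoord p) p

/-- Since `relCoord p p = 1` for every `p`, all the derivatives land in the single tangent space at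
`1`, and the diagonal lemma applies. -/
theorem contMDiffAt_form [IsManifold 𝓘(ℝ, V) ∞ P] [LieGroup 𝓘(ℝ, W) ∞ G]
    (s : LocalGauge U A π) (h : IsPrincipalBundle U A π) (x₀ : TangentBundle 𝓘(ℝ, V) P)
    (hx : π x₀.proj ∈ s.dom) :
    ContMDiffAt 𝓘(ℝ, V).tangent 𝓘(ℝ, W) ∞
      (fun x : TangentBundle 𝓘(ℝ, V) P => s.form x.proj x.snd) x₀ := by
  refine contMDiffAt_mfderiv_diagonal s.relCoord_self x₀ ?_
  have h1 : ContMDiffAt (𝓘(ℝ, V).prod 𝓘(ℝ, V)) 𝓘(ℝ, W) ∞ (fun q : P × P => s.coord q.1)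
      (x₀.proj, x₀.proj) := (s.contMDiffAt_coord h hx).comp (x₀.proj, x₀.proj) contMDiffAt_fst
  have h2 : ContMDiffAt (𝓘(ℝ, V).prod 𝓘(ℝ, V)) 𝓘(ℝ, W) ∞ (fun q : P × P => s.coord q.2)
      (x₀.proj, x₀.proj) := (s.contMDiffAt_coord h hx).comp (x₀.proj, x₀.proj) contMDiffAt_snd
  exact h1.inv.mul h2

/-- Along the orbit of `p`, the relative coordinate of `p g` is `g` itself. -/
theorem form_fundamental [LieGroup 𝓘(ℝ, W) ∞ G] (s : LocalGauge U A π)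
    (h : IsPrincipalBundle U A π) {p : P} (hp : π p ∈ s.dom) (B : W) :
    s.form p (A.fundamental p B) = B := by
  have c := mfderiv_comp_model (g := s.relCoord p) (1 : G) (A.act_one p)
    (s.mdifferentiableAt_relCoord h p hp)
    ((A.contMDiff_act_left p).mdifferentiableAt (by simp)) B
  refine c.symm.trans ?_
  have hid : (fun g => s.relCoord p (A.act p g)) = id := by
    funext g
    simp [relCoord, s.coord_act hp]
  rw [hid, mfderiv_id]
  rfl

/-- Moving both `p` and `q` by `g` conjugates the relative coordinate by `g⁻¹`; differentiate in
`q`. -/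
theorem form_mfderiv_act [LieGroup 𝓘(ℝ, W) ∞ G] (s : LocalGauge U A π)
    (h : IsPrincipalBundle U A π) {p : P} (hp : π p ∈ s.dom) (g : G) (v : V) :
    s.form (A.act p g) ((mfderiv 𝓘(ℝ, V) 𝓘(ℝ, V) (fun q => A.act q g) p : V →L[ℝ] V) v) =
      (adjointAction W g⁻¹ : W →L[ℝ] W) (s.form p v) := by
  have hpg : π (A.act p g) ∈ s.dom := by rwa [h.proj_act]
  have hc : ContMDiff 𝓘(ℝ, W) 𝓘(ℝ, W) ∞ (fun h : G => g⁻¹ * h * g⁻¹⁻¹) :=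
    (contMDiff_const.mul contMDiff_id).mul contMDiff_const
  have c1 := mfderiv_comp_model (g := s.relCoord (A.act p g)) p (rfl : A.act p g = A.act p g)
    (s.mdifferentiableAt_relCoord h _ hpg)
    ((A.contMDiff_act_right g).mdifferentiableAt (by simp)) v
  have c2 := mfderiv_comp_model (f := s.relCoord p) p (s.relCoord_self p)
    (hc.mdifferentiableAt (by simp)) (s.mdifferentiableAt_relCoord h p hp) v
  refine c1.symm.trans (Eq.trans ?_ c2)
  have he : (fun q => s.relCoord (A.act p g) (A.act q g)) =ᶠ[𝓝 p]
      fun q => g⁻¹ * s.relCoord p q * g⁻¹⁻¹ := by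
    filter_upwards [(s.isOpen_preimage h).mem_nhds hp] with q hq
    simp only [relCoord, s.coord_act hp, s.coord_act hq]
    group
  exact congrArg (fun L : V →L[ℝ] W => L v) he.mfderiv_eq

variable {A' : SmoothRightAction V' P' W' G'} {π' : P' → M}

/-- Apply `F` to `p = sec (π p) · coord p`: equivariance together with matching sections exhibits
the coordinate of the image. -/
theorem hom_coord (F : SmoothRightAction.EquivariantMap A A') (s : LocalGauge U A π)
    (s' : LocalGauge U A' π') (hdom : s.dom ⊆ s'.dom)
    (hsec : ∀ x ∈ s.dom, F.toFun (s.sec x) = s'.sec x) {p : P} (hp : π p ∈ s.dom) :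
    s'.coord (F.toFun p) = F.hom (s.coord p) := by
  conv_lhs => rw [← s.sec_act_coord p hp, F.map_act, hsec _ hp]
  exact s'.coord_sec_act _ (hdom hp) _

/-- By `hom_coord`, `F.hom` carries relative coordinates to relative coordinates near `p`; both
sides are derivatives of that one map. -/
theorem lieAlgebraMap_form [LieGroup 𝓘(ℝ, W) ∞ G] [LieGroup 𝓘(ℝ, W') ∞ G']
    (F : SmoothRightAction.EquivariantMap A A') (s : LocalGauge U A π)
    (s' : LocalGauge U A' π') (h : IsPrincipalBundle U A π) (h' : IsPrincipalBundle U A' π')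
    (hF : ∀ p, π' (F.toFun p) = π p) (hdom : s.dom ⊆ s'.dom)
    (hsec : ∀ x ∈ s.dom, F.toFun (s.sec x) = s'.sec x) {p : P} (hp : π p ∈ s.dom) (v : V) :
    (lieAlgebraMap W W' F.hom : W →L[ℝ] W') (s.form p v) =
      s'.form (F.toFun p) ((mfderiv 𝓘(ℝ, V) 𝓘(ℝ, V') F.toFun p : V →L[ℝ] V') v) := by
  have hp' : π' (F.toFun p) ∈ s'.dom := by rw [hF]; exact hdom hp
  have c1 := mfderiv_comp_model (g := s'.relCoord (F.toFun p)) p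
    (rfl : F.toFun p = F.toFun p) (s'.mdifferentiableAt_relCoord h' _ hp')
    (F.contMDiff_toFun.mdifferentiableAt (by simp)) v
  have c2 := mfderiv_comp_model (g := fun g => F.hom g) (f := s.relCoord p) p (s.relCoord_self p)
    (F.contMDiff_hom.mdifferentiableAt (by simp)) (s.mdifferentiableAt_relCoord h p hp) v
  refine c2.symm.trans (Eq.trans ?_ c1)
  have he : (fun q => F.hom (s.relCoord p q)) =ᶠ[𝓝 p]
      fun q => s'.relCoord (F.toFun p) (F.toFun q) := by
    filter_upwards [(s.isOpen_preimage h).mem_nhds hp] with q hq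
    simp only [relCoord, map_mul, map_inv, hom_coord F s s' hdom hsec hp,
      hom_coord F s s' hdom hsec hq]
  exact congrArg (fun L : V →L[ℝ] W' => L v) he.mfderiv_eq

end LocalGauge

end Gauge

/-! ### Composition in a Lie 2-group and in its Lie algebra. -/

section TwoGroup

variable {W₁ : Type*} [NormedAddCommGroup W₁] [NormedSpace ℝ W₁]
  {G₁ : Type*} [TopologicalSpace G₁] [ChartedSpace W₁ G₁] [Group G₁] [LieGroup 𝓘(ℝ, W₁) ∞ G₁]
  {W₀ : Type*} [NormedAddCommGroup W₀] [NormedSpace ℝ W₀]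
  {G₀ : Type*} [TopologicalSpace G₀] [ChartedSpace W₀ G₀] [Group G₀] [LieGroup 𝓘(ℝ, W₀) ∞ G₀]

namespace LieTwoGroup

variable (𝔾 : LieTwoGroup W₁ G₁ W₀ G₀)

/-- The source homomorphism. -/
def srcHom : G₁ →* G₀ := MonoidHom.mk' 𝔾.src 𝔾.src_mul

/-- The target homomorphism. -/
def tgtHom : G₁ →* G₀ := MonoidHom.mk' 𝔾.tgt 𝔾.tgt_mul

/-- The unit homomorphism. -/
def unitHom : G₀ →* G₁ := MonoidHom.mk' 𝔾.unit 𝔾.unit_mul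

theorem src_one : 𝔾.src 1 = 1 := map_one 𝔾.srcHom

theorem tgt_one : 𝔾.tgt 1 = 1 := map_one 𝔾.tgtHom

theorem unit_one : 𝔾.unit 1 = 1 := map_one 𝔾.unitHom

theorem src_group_inv (k : G₁) : 𝔾.src k⁻¹ = (𝔾.src k)⁻¹ := map_inv 𝔾.srcHom k

theorem tgt_group_inv (k : G₁) : 𝔾.tgt k⁻¹ = (𝔾.tgt k)⁻¹ := map_inv 𝔾.tgtHom k

theorem comp_one_one : 𝔾.comp 1 1 = 1 := by
  have h := 𝔾.comp_unit 1
  rwa [𝔾.src_one, 𝔾.unit_one] at h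

/-- Interchange turns `comp k⁻¹ l⁻¹ * comp k l` into `comp 1 1 = 1`. -/
theorem comp_group_inv {k l : G₁} (h : 𝔾.src k = 𝔾.tgt l) :
    𝔾.comp k⁻¹ l⁻¹ = (𝔾.comp k l)⁻¹ := by
  have h' : 𝔾.src k⁻¹ = 𝔾.tgt l⁻¹ := by rw [src_group_inv, tgt_group_inv, h]
  have e := 𝔾.comp_mul k⁻¹ l⁻¹ k l h' h
  rw [inv_mul_cancel, inv_mul_cancel, comp_one_one] at e
  exact eq_inv_of_mul_eq_one_left e.symm

/-- The smooth extension of the composition of a Lie 2-group to all pairs of arrows. -/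
def compExt (q : G₁ × G₁) : G₁ := q.1 * (𝔾.unit (𝔾.src q.1))⁻¹ * q.2

/-- With `u = unit (src k)`, write `k = k * 1` and `l = u * (u⁻¹ * l)`. Interchange splits the
composite into `comp k u = k` times `comp 1 (u⁻¹ * l)`, and the latter is `u⁻¹ * l` because its
target is `1`. -/
theorem comp_eq_compExt {k l : G₁} (h : 𝔾.src k = 𝔾.tgt l) : 𝔾.comp k l = 𝔾.compExt (k, l) := by
  have h1 : 𝔾.tgt ((𝔾.unit (𝔾.src k))⁻¹ * l) = 1 := by
    rw [𝔾.tgt_mul, tgt_group_inv, 𝔾.tgt_unit, h, inv_mul_cancel]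
  have e := 𝔾.comp_mul k (𝔾.unit (𝔾.src k)) 1 ((𝔾.unit (𝔾.src k))⁻¹ * l)
    (𝔾.tgt_unit _).symm (by rw [h1, src_one])
  have e2 := 𝔾.unit_comp ((𝔾.unit (𝔾.src k))⁻¹ * l)
  rw [h1, unit_one] at e2
  rwa [mul_one, mul_inv_cancel_left, 𝔾.comp_unit, e2, ← mul_assoc] at e

theorem contMDiff_compExt :
    ContMDiff (𝓘(ℝ, W₁).prod 𝓘(ℝ, W₁)) 𝓘(ℝ, W₁) ∞ 𝔾.compExt :=
  (contMDiff_fst.mul ((𝔾.contMDiff_unit.comp (𝔾.contMDiff_src.comp contMDiff_fst)).inv)).mul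
    contMDiff_snd

/-- The composition of `L(𝔾)`, extended linearly to all pairs of vectors. -/
noncomputable def lieComp : W₁ × W₁ →L[ℝ] W₁ :=
  mfderiv (𝓘(ℝ, W₁).prod 𝓘(ℝ, W₁)) 𝓘(ℝ, W₁) 𝔾.compExt (1, 1)

/-- Because `compExt` agrees with `comp` on composable pairs, its ordinary derivative at `(1, 1)` is
an admissible derivative of `comp` within them. -/
theorem isTangentComp_lieComp (K₂ K₁ : W₁)
    (h : (lieAlgebraMap W₁ W₀ 𝔾.srcHom : W₁ →L[ℝ] W₀) K₂ =
      (lieAlgebraMap W₁ W₀ 𝔾.tgtHom : W₁ →L[ℝ] W₀) K₁) :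
    𝔾.IsTangentComp (⟨1, K₂⟩ : TangentBundle 𝓘(ℝ, W₁) G₁) ⟨1, K₁⟩ ⟨1, 𝔾.lieComp (K₂, K₁)⟩ := by
  refine ⟨tangentBundle_mk_congr (𝔾.src_one.trans 𝔾.tgt_one.symm) h, 𝔾.lieComp, ?_,
    tangentBundle_mk_congr 𝔾.comp_one_one.symm rfl⟩
  have hd : HasMFDerivAt (𝓘(ℝ, W₁).prod 𝓘(ℝ, W₁)) 𝓘(ℝ, W₁) 𝔾.compExt ((1 : G₁), (1 : G₁))
      𝔾.lieComp := (𝔾.contMDiff_compExt.mdifferentiableAt (by simp)).hasMFDerivAt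
  exact (hd.hasMFDerivWithinAt (s := {q : G₁ × G₁ | 𝔾.src q.1 = 𝔾.tgt q.2})).congr_of_eventuallyEq
    (Filter.eventuallyEq_of_mem self_mem_nhdsWithin fun q hq => 𝔾.comp_eq_compExt hq)
    (𝔾.comp_eq_compExt (𝔾.src_one.trans 𝔾.tgt_one.symm))

end LieTwoGroup

end TwoGroup

/-! ### Gauges of a principal 2-bundle over a manifold, and multiplicativity of their forms. -/

section TwoBundle

variable {V₁ : Type*} [NormedAddCommGroup V₁] [NormedSpace ℝ V₁]
  {E₁ : Type*} [TopologicalSpace E₁] [ChartedSpace V₁ E₁]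
  {V₀ : Type*} [NormedAddCommGroup V₀] [NormedSpace ℝ V₀]
  {E₀ : Type*} [TopologicalSpace E₀] [ChartedSpace V₀ E₀]
  {W₁ : Type*} [NormedAddCommGroup W₁] [NormedSpace ℝ W₁]
  {G₁ : Type*} [TopologicalSpace G₁] [ChartedSpace W₁ G₁] [Group G₁] [LieGroup 𝓘(ℝ, W₁) ∞ G₁]
  {W₀ : Type*} [NormedAddCommGroup W₀] [NormedSpace ℝ W₀]
  {G₀ : Type*} [TopologicalSpace G₀] [ChartedSpace W₀ G₀] [Group G₀] [LieGroup 𝓘(ℝ, W₀) ∞ G₀]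
  {U : Type*} [NormedAddCommGroup U] [NormedSpace ℝ U]
  {X : Type*} [TopologicalSpace X] [ChartedSpace U X]
  {𝔾 : LieTwoGroup W₁ G₁ W₀ G₀} {𝔼 : LieGroupoid V₁ E₁ V₀ E₀}

namespace PrincipalTwoBundle

variable (𝔓 : PrincipalTwoBundle 𝔾 𝔼 (LieGroupoid.discrete U X))

/-- This and the next lemmas are where discreteness of the base enters: no structure map of `𝔼`
moves the point of `X`. -/
theorem proj₀_src (γ : E₁) : 𝔓.proj₀ (𝔼.src γ) = 𝔓.proj₁ γ := (𝔓.src_proj γ).symm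

theorem proj₀_tgt (γ : E₁) : 𝔓.proj₀ (𝔼.tgt γ) = 𝔓.proj₁ γ := (𝔓.tgt_proj γ).symm

theorem proj₁_unit (p : E₀) : 𝔓.proj₁ (𝔼.unit p) = 𝔓.proj₀ p := 𝔓.proj_unit p

theorem proj₁_comp {γ₂ γ₁ : E₁} (h : 𝔼.src γ₂ = 𝔼.tgt γ₁) :
    𝔓.proj₁ (𝔼.comp γ₂ γ₁) = 𝔓.proj₁ γ₂ := 𝔓.proj_comp γ₂ γ₁ h

theorem proj₁_eq_of_composable {γ₂ γ₁ : E₁} (h : 𝔼.src γ₂ = 𝔼.tgt γ₁) :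
    𝔓.proj₁ γ₂ = 𝔓.proj₁ γ₁ := by
  rw [← 𝔓.proj₀_src, h, 𝔓.proj₀_tgt]

/-- A local gauge of a principal 2-bundle over a manifold: local gauges of the bundles of arrows
and objects over the same open set, the section of the former consisting of the units of the
section of the latter. -/
structure Gauge where
  arrows : LocalGauge U 𝔓.action₁ 𝔓.proj₁
  objects : LocalGauge U 𝔓.action₀ 𝔓.proj₀
  dom_eq : arrows.dom = objects.dom
  sec_eq : ∀ x, arrows.sec x = 𝔼.unit (objects.sec x)

/-- Units over a local section of the objects form a local section of the arrows; the object gauge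
is then shrunk to the domain obtained for the arrows. -/
theorem exists_gauge_mem (x : X) : ∃ s : 𝔓.Gauge, x ∈ s.objects.dom := by
  obtain ⟨s₀, hx₀⟩ := 𝔓.isPrincipalBundle₀.exists_localGauge_mem x
  obtain ⟨s₁, hx₁, hsub, hsec⟩ := 𝔓.isPrincipalBundle₁.exists_localGauge s₀.isOpen_dom
    (𝔼.contMDiff_unit.comp_contMDiffOn s₀.contMDiffOn_sec)
    (fun y hy => (𝔓.proj₁_unit _).trans (s₀.proj_sec y hy)) hx₀
  exact ⟨⟨s₁, s₀.restrict s₁.dom s₁.isOpen_dom hsub, rfl, fun y => by rw [hsec]; rfl⟩, hx₁⟩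

namespace Gauge

variable {𝔓} (s : 𝔓.Gauge)

theorem src_sec (x : X) : 𝔼.src (s.arrows.sec x) = s.objects.sec x := by
  rw [s.sec_eq, 𝔼.src_unit]

theorem tgt_sec (x : X) : 𝔼.tgt (s.arrows.sec x) = s.objects.sec x := by
  rw [s.sec_eq, 𝔼.tgt_unit]

theorem mem_dom {γ : E₁} (h : 𝔓.proj₁ γ ∈ s.objects.dom) : 𝔓.proj₁ γ ∈ s.arrows.dom :=
  s.dom_eq ▸ h

theorem coord_src {γ : E₁} (h : 𝔓.proj₁ γ ∈ s.objects.dom) :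
    s.objects.coord (𝔼.src γ) = 𝔾.src (s.arrows.coord γ) :=
  LocalGauge.hom_coord 𝔓.srcMap s.arrows s.objects s.dom_eq.le (fun x _ => s.src_sec x)
    (s.mem_dom h)

theorem coord_tgt {γ : E₁} (h : 𝔓.proj₁ γ ∈ s.objects.dom) :
    s.objects.coord (𝔼.tgt γ) = 𝔾.tgt (s.arrows.coord γ) :=
  LocalGauge.hom_coord 𝔓.tgtMap s.arrows s.objects s.dom_eq.le (fun x _ => s.tgt_sec x)
    (s.mem_dom h)

theorem src_coord_eq {γ₂ γ₁ : E₁} (h : 𝔼.src γ₂ = 𝔼.tgt γ₁) (h₂ : 𝔓.proj₁ γ₂ ∈ s.objects.dom) :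
    𝔾.src (s.arrows.coord γ₂) = 𝔾.tgt (s.arrows.coord γ₁) := by
  rw [← s.coord_src h₂, h, s.coord_tgt (𝔓.proj₁_eq_of_composable h ▸ h₂)]

/-- Both arrows are translates of the same unit arrow `σ`, and functoriality of the action gives `(σ
k₂) ∘ (σ k₁) = (σ ∘ σ)(k₂ ∘ k₁) = σ (k₂ ∘ k₁)`. -/
theorem coord_comp {γ₂ γ₁ : E₁} (h : 𝔼.src γ₂ = 𝔼.tgt γ₁) (h₂ : 𝔓.proj₁ γ₂ ∈ s.objects.dom) :
    s.arrows.coord (𝔼.comp γ₂ γ₁) = 𝔾.comp (s.arrows.coord γ₂) (s.arrows.coord γ₁) := by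
  have hπ := 𝔓.proj₁_eq_of_composable h
  have h₁ : 𝔓.proj₁ γ₁ ∈ s.objects.dom := hπ ▸ h₂
  have e₂ := s.arrows.sec_act_coord γ₂ (s.mem_dom h₂)
  have e₁ := s.arrows.sec_act_coord γ₁ (s.mem_dom h₁)
  rw [← hπ] at e₁
  have hu : 𝔼.comp (s.arrows.sec (𝔓.proj₁ γ₂)) (s.arrows.sec (𝔓.proj₁ γ₂)) =
      s.arrows.sec (𝔓.proj₁ γ₂) := by
    have := 𝔼.comp_unit (s.arrows.sec (𝔓.proj₁ γ₂))
    rwa [s.src_sec, ← s.sec_eq] at this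
  have e := 𝔓.comp_act (s.arrows.sec (𝔓.proj₁ γ₂)) (s.arrows.sec (𝔓.proj₁ γ₂)) _ _
    (by rw [s.src_sec, s.tgt_sec]) (s.src_coord_eq h h₂)
  rw [e₂, e₁, hu] at e
  rw [← e]
  exact s.arrows.coord_sec_act _ (s.mem_dom h₂) _

theorem relCoord_comp {γ₂ γ₁ η₂ η₁ : E₁} (hγ : 𝔼.src γ₂ = 𝔼.tgt γ₁) (hη : 𝔼.src η₂ = 𝔼.tgt η₁)
    (hγ₂ : 𝔓.proj₁ γ₂ ∈ s.objects.dom) (hη₂ : 𝔓.proj₁ η₂ ∈ s.objects.dom) :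
    s.arrows.relCoord (𝔼.comp γ₂ γ₁) (𝔼.comp η₂ η₁) =
      𝔾.compExt (s.arrows.relCoord γ₂ η₂, s.arrows.relCoord γ₁ η₁) := by
  have h₁ := s.src_coord_eq hγ hγ₂
  have h₂ := s.src_coord_eq hη hη₂
  have h₁' : 𝔾.src (s.arrows.coord γ₂)⁻¹ = 𝔾.tgt (s.arrows.coord γ₁)⁻¹ := by
    rw [𝔾.src_group_inv, 𝔾.tgt_group_inv, h₁]
  rw [← 𝔾.comp_eq_compExt, LocalGauge.relCoord, s.coord_comp hγ hγ₂, s.coord_comp hη hη₂,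
    ← 𝔾.comp_group_inv h₁, ← 𝔾.comp_mul _ _ _ _ h₁' h₂]
  · rfl
  · simp only [LocalGauge.relCoord, 𝔾.src_mul, 𝔾.tgt_mul, h₁', h₂]

/-- Transport of an arrow over the domain of a gauge to one with the prescribed source. -/
def moveSrc (q : E₁ × E₀) : E₁ :=
  𝔓.action₁.act (s.arrows.sec (𝔓.proj₀ q.2))
    (s.arrows.coord q.1 * 𝔾.unit ((𝔾.src (s.arrows.coord q.1))⁻¹ * s.objects.coord q.2))

/-- The unit factor in `moveSrc` changes the source of the group coordinate into the coordinate of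
`p`. -/
theorem src_moveSrc (γ : E₁) {p : E₀} (hp : 𝔓.proj₀ p ∈ s.objects.dom) :
    𝔼.src (s.moveSrc (γ, p)) = p := by
  rw [moveSrc, 𝔓.src_act, s.src_sec, 𝔾.src_mul, 𝔾.src_unit, mul_inv_cancel_left]
  exact s.objects.sec_act_coord p hp

theorem moveSrc_src {γ : E₁} (hγ : 𝔓.proj₁ γ ∈ s.objects.dom) :
    s.moveSrc (γ, 𝔼.src γ) = γ := by
  rw [moveSrc, 𝔓.proj₀_src, s.coord_src hγ, inv_mul_cancel, 𝔾.unit_one, mul_one]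
  exact s.arrows.sec_act_coord γ (s.mem_dom hγ)

theorem proj₁_moveSrc (γ : E₁) {p : E₀} (hp : 𝔓.proj₀ p ∈ s.objects.dom) :
    𝔓.proj₁ (s.moveSrc (γ, p)) = 𝔓.proj₀ p := by
  rw [← 𝔓.proj₀_src, s.src_moveSrc γ hp]

theorem contMDiffAt_moveSrc {γ : E₁} {p : E₀} (hγ : 𝔓.proj₁ γ ∈ s.objects.dom)
    (hp : 𝔓.proj₀ p ∈ s.objects.dom) :
    ContMDiffAt (𝓘(ℝ, V₁).prod 𝓘(ℝ, V₀)) 𝓘(ℝ, V₁) ∞ s.moveSrc (γ, p) := by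
  have h₁ : ContMDiffAt (𝓘(ℝ, V₁).prod 𝓘(ℝ, V₀)) 𝓘(ℝ, W₁) ∞
      (fun q : E₁ × E₀ => s.arrows.coord q.1) (γ, p) :=
    (s.arrows.contMDiffAt_coord 𝔓.isPrincipalBundle₁ (s.mem_dom hγ)).comp (γ, p) contMDiffAt_fst
  have h₀ : ContMDiffAt (𝓘(ℝ, V₁).prod 𝓘(ℝ, V₀)) 𝓘(ℝ, W₀) ∞
      (fun q : E₁ × E₀ => s.objects.coord q.2) (γ, p) :=
    (s.objects.contMDiffAt_coord 𝔓.isPrincipalBundle₀ hp).comp (γ, p) contMDiffAt_snd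
  have hσ : ContMDiffAt (𝓘(ℝ, V₁).prod 𝓘(ℝ, V₀)) 𝓘(ℝ, V₁) ∞
      (fun q : E₁ × E₀ => s.arrows.sec (𝔓.proj₀ q.2)) (γ, p) :=
    ContMDiffAt.comp (γ, p) (g := s.arrows.sec) (f := fun q : E₁ × E₀ => 𝔓.proj₀ q.2)
      (s.arrows.contMDiffOn_sec.contMDiffAt (s.arrows.isOpen_dom.mem_nhds (s.dom_eq ▸ hp)))
      (𝔓.isPrincipalBundle₀.contMDiff_proj.comp contMDiff_snd).contMDiffAt
  have hs : ContMDiffAt (𝓘(ℝ, V₁).prod 𝓘(ℝ, V₀)) 𝓘(ℝ, W₀) ∞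
      (fun q : E₁ × E₀ => 𝔾.src (s.arrows.coord q.1)) (γ, p) :=
    𝔾.contMDiff_src.contMDiffAt.comp (γ, p) h₁
  have hu : ContMDiffAt (𝓘(ℝ, V₁).prod 𝓘(ℝ, V₀)) 𝓘(ℝ, W₁) ∞
      (fun q : E₁ × E₀ => 𝔾.unit ((𝔾.src (s.arrows.coord q.1))⁻¹ * s.objects.coord q.2))
      (γ, p) := 𝔾.contMDiff_unit.contMDiffAt.comp (γ, p) (hs.inv.mul h₀)
  exact 𝔓.action₁.contMDiff_act.contMDiffAt.comp (γ, p) (hσ.prodMk (h₁.mul hu))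

/-- On composable vectors the derivative of `tgt` along `v₁` may be replaced by that of `src` along
`v₂`. What is then differentiated is `γ ↦ moveSrc (γ, src γ)`, which is the identity near `γ₂`. -/
theorem mfderiv_moveSrc {γ₂ γ₁ : E₁} (h : 𝔼.src γ₂ = 𝔼.tgt γ₁)
    (h₂ : 𝔓.proj₁ γ₂ ∈ s.objects.dom) (v₂ v₁ : V₁)
    (hv : (mfderiv 𝓘(ℝ, V₁) 𝓘(ℝ, V₀) 𝔼.src γ₂ : V₁ →L[ℝ] V₀) v₂ =
      (mfderiv 𝓘(ℝ, V₁) 𝓘(ℝ, V₀) 𝔼.tgt γ₁ : V₁ →L[ℝ] V₀) v₁) :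
    (mfderiv (𝓘(ℝ, V₁).prod 𝓘(ℝ, V₁)) 𝓘(ℝ, V₁)
      (fun y : E₁ × E₁ => s.moveSrc (y.1, 𝔼.tgt y.2)) (γ₂, γ₁) : V₁ × V₁ →L[ℝ] V₁) (v₂, v₁) =
      v₂ := by
  have hs : MDifferentiable 𝓘(ℝ, V₁) 𝓘(ℝ, V₀) 𝔼.src := 𝔼.contMDiff_src.mdifferentiable (by simp)
  have ht : MDifferentiable 𝓘(ℝ, V₁) 𝓘(ℝ, V₀) 𝔼.tgt := 𝔼.contMDiff_tgt.mdifferentiable (by simp)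
  have hm : MDifferentiableAt (𝓘(ℝ, V₁).prod 𝓘(ℝ, V₀)) 𝓘(ℝ, V₁) s.moveSrc (γ₂, 𝔼.src γ₂) :=
    (s.contMDiffAt_moveSrc h₂ (by rwa [𝔓.proj₀_src])).mdifferentiableAt (by simp)
  have hfst : MDifferentiableAt (𝓘(ℝ, V₁).prod 𝓘(ℝ, V₁)) 𝓘(ℝ, V₁)
      (fun y : E₁ × E₁ => y.1) (γ₂, γ₁) := mdifferentiableAt_fst
  have hsnd : MDifferentiableAt (𝓘(ℝ, V₁).prod 𝓘(ℝ, V₁)) 𝓘(ℝ, V₁)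
      (fun y : E₁ × E₁ => y.2) (γ₂, γ₁) := mdifferentiableAt_snd
  have htsnd : MDifferentiableAt (𝓘(ℝ, V₁).prod 𝓘(ℝ, V₁)) 𝓘(ℝ, V₀)
      (fun y : E₁ × E₁ => 𝔼.tgt y.2) (γ₂, γ₁) := (ht γ₁).comp (γ₂, γ₁) hsnd
  have hid : MDifferentiableAt 𝓘(ℝ, V₁) 𝓘(ℝ, V₁) (fun γ : E₁ => γ) γ₂ := mdifferentiableAt_id
  have c1 := mfderiv_comp_model (g := s.moveSrc) (f := fun y : E₁ × E₁ => (y.1, 𝔼.tgt y.2))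
    (γ₂, γ₁) (by rw [h] : _ = (γ₂, 𝔼.src γ₂)) hm (hfst.prodMk htsnd) (v₂, v₁)
  have c2 := mfderiv_comp_model (g := s.moveSrc) (f := fun γ : E₁ => (γ, 𝔼.src γ)) γ₂ rfl hm
    (hid.prodMk (hs γ₂)) v₂
  have d1 := mfderiv_prodMk_model hfst htsnd (v₂, v₁)
  have d2 := mfderiv_prodMk_model hid (hs γ₂) v₂
  have c3 := mfderiv_comp_model (g := 𝔼.tgt) (f := fun y : E₁ × E₁ => y.2) (γ₂, γ₁) rfl (ht γ₁)
    hsnd (v₂, v₁)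
  have f1 : (mfderiv (𝓘(ℝ, V₁).prod 𝓘(ℝ, V₁)) 𝓘(ℝ, V₁) (fun y : E₁ × E₁ => y.1) (γ₂, γ₁) :
      V₁ × V₁ →L[ℝ] V₁) (v₂, v₁) = v₂ := congrArg (fun L : V₁ × V₁ →L[ℝ] V₁ => L (v₂, v₁))
    (mfderiv_fst (I := 𝓘(ℝ, V₁)) (I' := 𝓘(ℝ, V₁)) (x := (γ₂, γ₁)))
  have f2 : (mfderiv (𝓘(ℝ, V₁).prod 𝓘(ℝ, V₁)) 𝓘(ℝ, V₁) (fun y : E₁ × E₁ => y.2) (γ₂, γ₁) :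
      V₁ × V₁ →L[ℝ] V₁) (v₂, v₁) = v₁ := congrArg (fun L : V₁ × V₁ →L[ℝ] V₁ => L (v₂, v₁))
    (mfderiv_snd (I := 𝓘(ℝ, V₁)) (I' := 𝓘(ℝ, V₁)) (x := (γ₂, γ₁)))
  have f3 : (mfderiv 𝓘(ℝ, V₁) 𝓘(ℝ, V₁) (fun γ : E₁ => γ) γ₂ : V₁ →L[ℝ] V₁) v₂ = v₂ :=
    congrArg (fun L : V₁ →L[ℝ] V₁ => L v₂) (mfderiv_id (I := 𝓘(ℝ, V₁)) (x := γ₂))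
  rw [d1, c3, f1, f2, ← hv] at c1
  rw [d2, f3] at c2
  refine c1.trans (c2.symm.trans ?_)
  have he : (fun γ => s.moveSrc (γ, 𝔼.src γ)) =ᶠ[𝓝 γ₂] fun γ => γ := by
    have ho := (s.arrows.isOpen_preimage 𝔓.isPrincipalBundle₁).mem_nhds (s.mem_dom h₂)
    filter_upwards [ho] with γ hγ
    exact s.moveSrc_src (s.dom_eq ▸ hγ)
  exact (congrArg (fun L : V₁ →L[ℝ] V₁ => L v₂) he.mfderiv_eq).trans f3

/-- The flat connection form of a gauge is multiplicative. -/
theorem form_comp {γ₂ γ₁ : E₁} (h : 𝔼.src γ₂ = 𝔼.tgt γ₁)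
    (h₂ : 𝔓.proj₁ γ₂ ∈ s.objects.dom) (v₂ v₁ : V₁)
    (hv : (mfderiv 𝓘(ℝ, V₁) 𝓘(ℝ, V₀) 𝔼.src γ₂ : V₁ →L[ℝ] V₀) v₂ =
      (mfderiv 𝓘(ℝ, V₁) 𝓘(ℝ, V₀) 𝔼.tgt γ₁ : V₁ →L[ℝ] V₀) v₁)
    {D : V₁ × V₁ →L[ℝ] V₁}
    (hD : HasMFDerivWithinAt (𝓘(ℝ, V₁).prod 𝓘(ℝ, V₁)) 𝓘(ℝ, V₁)
      (fun q : E₁ × E₁ => 𝔼.comp q.1 q.2) {q : E₁ × E₁ | 𝔼.src q.1 = 𝔼.tgt q.2} (γ₂, γ₁) D) :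
    s.arrows.form (𝔼.comp γ₂ γ₁) (D (v₂, v₁)) =
      𝔾.lieComp (s.arrows.form γ₂ v₂, s.arrows.form γ₁ v₁) := by
  have hπ := 𝔓.proj₁_eq_of_composable h
  have h₁ : 𝔓.proj₁ γ₁ ∈ s.objects.dom := hπ ▸ h₂
  have h₂₁ : 𝔓.proj₁ (𝔼.comp γ₂ γ₁) ∈ s.objects.dom := by rwa [𝔓.proj₁_comp h]
  have hfix : s.moveSrc (γ₂, 𝔼.tgt γ₁) = γ₂ := by rw [← h, s.moveSrc_src h₂]
  have hfst : MDifferentiableAt (𝓘(ℝ, V₁).prod 𝓘(ℝ, V₁)) 𝓘(ℝ, V₁)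
      (fun y : E₁ × E₁ => y.1) (γ₂, γ₁) := mdifferentiableAt_fst
  have hsnd : MDifferentiableAt (𝓘(ℝ, V₁).prod 𝓘(ℝ, V₁)) 𝓘(ℝ, V₁)
      (fun y : E₁ × E₁ => y.2) (γ₂, γ₁) := mdifferentiableAt_snd
  have ht : MDifferentiableAt 𝓘(ℝ, V₁) 𝓘(ℝ, V₀) 𝔼.tgt γ₁ :=
    𝔼.contMDiff_tgt.mdifferentiableAt (by simp)
  have htsnd : MDifferentiableAt (𝓘(ℝ, V₁).prod 𝓘(ℝ, V₁)) 𝓘(ℝ, V₀)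
      (fun y : E₁ × E₁ => 𝔼.tgt y.2) (γ₂, γ₁) := ht.comp (γ₂, γ₁) hsnd
  have hm : MDifferentiableAt (𝓘(ℝ, V₁).prod 𝓘(ℝ, V₀)) 𝓘(ℝ, V₁) s.moveSrc (γ₂, 𝔼.tgt γ₁) :=
    (s.contMDiffAt_moveSrc h₂ (by rwa [𝔓.proj₀_tgt])).mdifferentiableAt (by simp)
  have hr₁ : MDifferentiableAt (𝓘(ℝ, V₁).prod 𝓘(ℝ, V₁)) 𝓘(ℝ, V₁)
      (fun y : E₁ × E₁ => s.moveSrc (y.1, 𝔼.tgt y.2)) (γ₂, γ₁) :=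
    MDifferentiableAt.comp (g := s.moveSrc) (f := fun y : E₁ × E₁ => (y.1, 𝔼.tgt y.2)) (γ₂, γ₁)
      hm (hfst.prodMk htsnd)
  -- Near `(γ₂, γ₁)`, `r` takes values in the composable pairs. It fixes `(γ₂, γ₁)`, and its
  -- differential fixes `(v₂, v₁)`.
  let r : E₁ × E₁ → E₁ × E₁ := fun y => (s.moveSrc (y.1, 𝔼.tgt y.2), y.2)
  have hr : MDifferentiableAt (𝓘(ℝ, V₁).prod 𝓘(ℝ, V₁)) (𝓘(ℝ, V₁).prod 𝓘(ℝ, V₁)) r (γ₂, γ₁) :=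
    hr₁.prodMk hsnd
  have hrfix : r (γ₂, γ₁) = (γ₂, γ₁) := Prod.ext hfix rfl
  have f2 : (mfderiv (𝓘(ℝ, V₁).prod 𝓘(ℝ, V₁)) 𝓘(ℝ, V₁) (fun y : E₁ × E₁ => y.2) (γ₂, γ₁) :
      V₁ × V₁ →L[ℝ] V₁) (v₂, v₁) = v₁ := congrArg (fun L : V₁ × V₁ →L[ℝ] V₁ => L (v₂, v₁))
    (mfderiv_snd (I := 𝓘(ℝ, V₁)) (I' := 𝓘(ℝ, V₁)) (x := (γ₂, γ₁)))
  have hdr := mfderiv_prodMk_model hr₁ hsnd (v₂, v₁)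
  rw [s.mfderiv_moveSrc h h₂ v₂ v₁ hv, f2] at hdr
  have hT : {y : E₁ × E₁ | 𝔓.proj₁ y.1 ∈ s.objects.dom ∧ 𝔓.proj₁ y.2 ∈ s.objects.dom} ∈
      𝓝 (γ₂, γ₁) := by
    have ho : IsOpen (𝔓.proj₁ ⁻¹' s.objects.dom) :=
      s.objects.isOpen_dom.preimage 𝔓.isPrincipalBundle₁.contMDiff_proj.continuous
    exact (ho.prod ho).mem_nhds (show (γ₂, γ₁) ∈ _ ×ˢ _ from ⟨h₂, h₁⟩)
  have hrmem : ∀ y : E₁ × E₁, 𝔓.proj₁ y.2 ∈ s.objects.dom → 𝔼.src (r y).1 = 𝔼.tgt (r y).2 :=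
    fun y hy => s.src_moveSrc y.1 (by rwa [𝔓.proj₀_tgt])
  -- Precomposition with `r` turns the derivative within composable pairs into one on a full
  -- neighbourhood, where the chain rule for `mfderiv` is available.
  have hcr : HasMFDerivAt (𝓘(ℝ, V₁).prod 𝓘(ℝ, V₁)) 𝓘(ℝ, V₁)
      (fun y : E₁ × E₁ => 𝔼.comp (r y).1 (r y).2) (γ₂, γ₁)
      (D.comp (mfderiv (𝓘(ℝ, V₁).prod 𝓘(ℝ, V₁)) (𝓘(ℝ, V₁).prod 𝓘(ℝ, V₁)) r (γ₂, γ₁) :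
        V₁ × V₁ →L[ℝ] V₁ × V₁)) := by
    rw [← hrfix] at hD
    exact (HasMFDerivWithinAt.comp (γ₂, γ₁) hD hr.hasMFDerivAt.hasMFDerivWithinAt
      (fun y hy => hrmem y hy.2)).hasMFDerivAt hT
  have hcomp : (fun y : E₁ × E₁ => 𝔼.comp (r y).1 (r y).2) (γ₂, γ₁) = 𝔼.comp γ₂ γ₁ := by
    simp only [hrfix]
  have c1 := mfderiv_comp_model (g := s.arrows.relCoord (𝔼.comp γ₂ γ₁)) (γ₂, γ₁) hcomp
    (s.arrows.mdifferentiableAt_relCoord 𝔓.isPrincipalBundle₁ _ (s.mem_dom h₂₁))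
    hcr.mdifferentiableAt (v₂, v₁)
  have hDr : (mfderiv (𝓘(ℝ, V₁).prod 𝓘(ℝ, V₁)) 𝓘(ℝ, V₁)
      (fun y : E₁ × E₁ => 𝔼.comp (r y).1 (r y).2) (γ₂, γ₁) : V₁ × V₁ →L[ℝ] V₁) (v₂, v₁) =
      D (v₂, v₁) :=
    (congrArg (fun L : V₁ × V₁ →L[ℝ] V₁ => L (v₂, v₁)) hcr.mfderiv).trans (congrArg D hdr)
  rw [hDr] at c1
  have hk₂ := s.arrows.mdifferentiableAt_relCoord 𝔓.isPrincipalBundle₁ γ₂ (s.mem_dom h₂)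
  have hk₁ := s.arrows.mdifferentiableAt_relCoord 𝔓.isPrincipalBundle₁ γ₁ (s.mem_dom h₁)
  have hκ₂ : MDifferentiableAt (𝓘(ℝ, V₁).prod 𝓘(ℝ, V₁)) 𝓘(ℝ, W₁)
      (fun y => s.arrows.relCoord γ₂ (r y).1) (γ₂, γ₁) :=
    MDifferentiableAt.comp_of_eq (g := s.arrows.relCoord γ₂)
      (f := fun y : E₁ × E₁ => s.moveSrc (y.1, 𝔼.tgt y.2)) (γ₂, γ₁) hk₂ hr₁
      hfix
  have hκ₁ : MDifferentiableAt (𝓘(ℝ, V₁).prod 𝓘(ℝ, V₁)) 𝓘(ℝ, W₁)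
      (fun y => s.arrows.relCoord γ₁ (r y).2) (γ₂, γ₁) :=
    MDifferentiableAt.comp (g := s.arrows.relCoord γ₁) (f := fun y : E₁ × E₁ => y.2) (γ₂, γ₁)
      hk₁ hsnd
  have c2 := mfderiv_comp_model (g := 𝔾.compExt)
    (f := fun y => (s.arrows.relCoord γ₂ (r y).1, s.arrows.relCoord γ₁ (r y).2)) (γ₂, γ₁)
    (by simp [hrfix] : _ = ((1 : G₁), (1 : G₁))) (𝔾.contMDiff_compExt.mdifferentiableAt (by simp))
    (hκ₂.prodMk hκ₁) (v₂, v₁)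
  have d2 := mfderiv_comp_model (g := s.arrows.relCoord γ₂) (γ₂, γ₁) hfix hk₂ hr₁ (v₂, v₁)
  have d1 := mfderiv_comp_model (g := s.arrows.relCoord γ₁) (γ₂, γ₁) rfl hk₁ hsnd (v₂, v₁)
  rw [s.mfderiv_moveSrc h h₂ v₂ v₁ hv] at d2
  rw [f2] at d1
  have d := mfderiv_prodMk_model hκ₂ hκ₁ (v₂, v₁)
  have d' := d.trans (Prod.ext d2 d1 : _ = (s.arrows.form γ₂ v₂, s.arrows.form γ₁ v₁))
  refine c1.symm.trans (Eq.trans ?_ (c2.trans (congrArg 𝔾.lieComp d')))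
  -- The two sides of the claim are the derivatives of these two locally equal maps.
  have he : (fun y => s.arrows.relCoord (𝔼.comp γ₂ γ₁) (𝔼.comp (r y).1 (r y).2)) =ᶠ[𝓝 (γ₂, γ₁)]
      fun y => 𝔾.compExt (s.arrows.relCoord γ₂ (r y).1, s.arrows.relCoord γ₁ (r y).2) := by
    filter_upwards [hT] with y hy
    refine s.relCoord_comp h (hrmem y hy.2) h₂ ?_
    have hy2 : 𝔓.proj₀ (𝔼.tgt y.2) ∈ s.objects.dom := by rw [𝔓.proj₀_tgt]; exact hy.2
    simp only [r]
    rwa [s.proj₁_moveSrc y.1 hy2]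
  exact congrArg (fun L : V₁ × V₁ →L[ℝ] W₁ => L (v₂, v₁)) he.mfderiv_eq

end Gauge

end PrincipalTwoBundle

end TwoBundle

/-! ### Connection forms, the maps `At → Ad` they induce, and averaging. -/

section ConnectionForm

variable {V : Type*} [NormedAddCommGroup V] [NormedSpace ℝ V]
  {P : Type*} [TopologicalSpace P] [ChartedSpace V P]
  {W : Type*} [NormedAddCommGroup W] [NormedSpace ℝ W]
  {G : Type*} [TopologicalSpace G] [ChartedSpace W G] [Group G]
  {U : Type*} [NormedAddCommGroup U] [NormedSpace ℝ U]
  {M : Type*} [TopologicalSpace M] [ChartedSpace U M]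
  {V' : Type*} [NormedAddCommGroup V'] [NormedSpace ℝ V']
  {P' : Type*} [TopologicalSpace P'] [ChartedSpace V' P']
  {W' : Type*} [NormedAddCommGroup W'] [NormedSpace ℝ W']
  {G' : Type*} [TopologicalSpace G'] [ChartedSpace W' G'] [Group G']

theorem adjointAction_one (B : W) : (adjointAction W (1 : G) : W →L[ℝ] W) B = B := by
  have h : (fun h : G => 1 * h * 1⁻¹) = id := by funext h; simp
  rw [adjointAction, h, mfderiv_id]
  rfl

theorem adjointAction_mul [LieGroup 𝓘(ℝ, W) ∞ G] (g h : G) (B : W) :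
    (adjointAction W (g * h) : W →L[ℝ] W) B =
      (adjointAction W g : W →L[ℝ] W) ((adjointAction W h : W →L[ℝ] W) B) := by
  have hc : ∀ g : G, MDifferentiable 𝓘(ℝ, W) 𝓘(ℝ, W) (fun h : G => g * h * g⁻¹) := fun g =>
    ((contMDiff_const.mul contMDiff_id).mul contMDiff_const : ContMDiff 𝓘(ℝ, W) 𝓘(ℝ, W) ∞
      (fun h : G => g * h * g⁻¹)).mdifferentiable (by simp)
  have c := mfderiv_comp_model (g := fun k : G => g * k * g⁻¹) (f := fun k : G => h * k * h⁻¹)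
    (1 : G) (by simp : _ = (1 : G)) (hc g 1) (hc h 1) B
  have e : (fun k : G => g * (h * k * h⁻¹) * g⁻¹) = fun k => g * h * k * (g * h)⁻¹ := by
    funext k; group
  rw [e] at c
  exact c

namespace SmoothRightAction

variable (A : SmoothRightAction V P W G)

/-- Being the orbit relation of an action, the relation defining `Ad` is already an equivalence, so
`Quot` adds no further identifications. -/
theorem Ad.exact [LieGroup 𝓘(ℝ, W) ∞ G] {p q : P} {B C : W} (h : Ad.mk A p B = Ad.mk A q C) :
    ∃ g : G, q = A.act p g ∧ C = (adjointAction W g⁻¹ : W →L[ℝ] W) B := by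
  have he : Equivalence (fun x y : P × GroupLieAlgebra 𝓘(ℝ, W) G =>
      ∃ g : G, y = (A.act x.1 g, adjointAction W g⁻¹ x.2)) := by
    refine ⟨fun x => ⟨1, Prod.ext (A.act_one _).symm ?_⟩, ?_, ?_⟩
    · exact (by rw [inv_one]; exact (adjointAction_one (W := W) (G := G) x.2).symm)
    · rintro x _ ⟨g, rfl⟩
      refine ⟨g⁻¹, Prod.ext ?_ ?_⟩
      · rw [← A.act_mul, mul_inv_cancel, A.act_one]
      · have := adjointAction_mul (W := W) (g⁻¹)⁻¹ g⁻¹ x.2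
        rw [inv_mul_cancel] at this
        exact (adjointAction_one (W := W) (G := G) x.2).symm.trans this
    · rintro x _ _ ⟨g, rfl⟩ ⟨h, rfl⟩
      refine ⟨g * h, Prod.ext (A.act_mul _ _ _).symm ?_⟩
      rw [mul_inv_rev]
      exact (adjointAction_mul (W := W) h⁻¹ g⁻¹ x.2).symm
  obtain ⟨g, hg⟩ := he.eqvGen_iff.1 (Quot.eqvGen_exact h)
  exact ⟨g, congrArg Prod.fst hg, congrArg Prod.snd hg⟩

variable {A}

theorem act_eq_self_iff [LieGroup 𝓘(ℝ, W) ∞ G] {π : P → M}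
    (h : IsPrincipalBundle U A π) {p : P} {g : G} :
    A.act p g = p ↔ g = 1 := by
  refine ⟨fun hg => ?_, fun hg => hg ▸ A.act_one p⟩
  obtain ⟨s, hs⟩ := h.exists_localGauge_mem (π p)
  have := s.coord_act hs g
  rwa [hg, left_eq_mul] at this

/-- Freeness of the action makes the representative over a fixed `p` unique; fibrewise linearity of
`toMap` rests on this. -/
theorem Ad.mk_injective [LieGroup 𝓘(ℝ, W) ∞ G] {π : P → M}
    (h : IsPrincipalBundle U A π) {p : P} {B C : W}
    (hBC : Ad.mk A p B = Ad.mk A p C) : B = C := by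
  obtain ⟨g, hg, hC⟩ := Ad.exact A hBC
  rw [(act_eq_self_iff h).1 hg.symm, inv_one, adjointAction_one] at hC
  exact hC.symm

/-- A connection form on `P`: a smooth equivariant `L(G)`-valued 1-form that reproduces the
generators of the fundamental vector fields. -/
structure IsConnectionForm [IsManifold 𝓘(ℝ, V) ∞ P] (A : SmoothRightAction V P W G)
    (θ : P → V →L[ℝ] W) : Prop where
  contMDiff : ContMDiff 𝓘(ℝ, V).tangent 𝓘(ℝ, W) ∞
    (fun x : TangentBundle 𝓘(ℝ, V) P => θ x.proj x.snd)
  mfderiv_act : ∀ p g (v : V),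
    θ (A.act p g) ((mfderiv 𝓘(ℝ, V) 𝓘(ℝ, V) (fun q => A.act q g) p : V →L[ℝ] V) v) =
      (adjointAction W g⁻¹ : W →L[ℝ] W) (θ p v)
  fundamental : ∀ p (B : W), θ p (A.fundamental p B) = B

namespace IsConnectionForm

variable [IsManifold 𝓘(ℝ, V) ∞ P] {θ : P → V →L[ℝ] W}

/-- The map `At(P) → Ad(P)`, `[(p, v)] ↦ [(p, θ_p(v))]`. -/
def toMap (hθ : IsConnectionForm A θ) : A.At → A.Ad :=
  Quot.map (fun x => (x.proj, θ x.proj x.snd)) (by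
    rintro x _ ⟨g, rfl⟩
    exact ⟨g, Prod.ext rfl (hθ.mfderiv_act x.proj g x.snd)⟩)

theorem isVectorBundleMap_toMap [LieGroup 𝓘(ℝ, W) ∞ G] (hθ : IsConnectionForm A θ)
    {π : P → M} (h : IsPrincipalBundle U A π) : IsVectorBundleMap h hθ.toMap where
  proj_map := by rintro ⟨x⟩; rfl
  linear p c v w B C hB hC := by
    have hB' : θ p v = B := Ad.mk_injective h hB
    have hC' : θ p w = C := Ad.mk_injective h hC
    have e : θ p (c • v + w) = c • B + C :=
      ((θ p).map_add _ _).trans (congrArg₂ (· + ·) (((θ p).map_smul c _).trans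
        (congrArg (c • ·) hB')) hC')
    exact congrArg (Ad.mk A p) e
  smooth x := ⟨Set.univ, Filter.univ_mem, fun y => y.proj, fun y => θ y.proj y.snd,
    (Bundle.contMDiff_proj (TangentSpace 𝓘(ℝ, V))).contMDiffOn, hθ.contMDiff.contMDiffOn,
    fun _ _ => rfl⟩

theorem toMap_j [LieGroup 𝓘(ℝ, W) ∞ G] (hθ : IsConnectionForm A θ) (a : A.Ad) :
    hθ.toMap (A.j a) = a := by
  obtain ⟨p, B⟩ := a
  exact congrArg (Ad.mk A p) (hθ.fundamental p B)

end IsConnectionForm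

end SmoothRightAction

namespace LocalGauge

variable {A : SmoothRightAction V P W G} {π : P → M} {ι : Type*}
  (ρ : SmoothPartitionOfUnity ι 𝓘(ℝ, U) M Set.univ) (s : ι → LocalGauge U A π)

/-- The average of the connection forms of local gauges with respect to a partition of unity. -/
noncomputable def average (p : P) : V →L[ℝ] W :=
  ∑ i ∈ ρ.finsupport (π p), ρ i (π p) • (s i).form p

theorem average_apply (p : P) (v : V) :
    average ρ s p v = ∑ i ∈ ρ.finsupport (π p), ρ i (π p) • (s i).form p v := by
  simp [average]

variable {ρ s}

theorem mem_dom_of_mem_finsupport (hs : ρ.IsSubordinate fun i => (s i).dom) {x : M} {i : ι}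
    (hi : i ∈ ρ.finsupport x) : x ∈ (s i).dom :=
  hs i (subset_tsupport _ ((ρ.mem_finsupport x).1 hi))

/-- The weights sum to `1`, so a value shared by all contributing gauges is kept. -/
theorem average_eq_of_forall (hs : ρ.IsSubordinate fun i => (s i).dom) {p : P} {v : V} {B : W}
    (hB : ∀ i, π p ∈ (s i).dom → (s i).form p v = B) : average ρ s p v = B := by
  have e : ∀ i ∈ ρ.finsupport (π p), ρ i (π p) • (s i).form p v = ρ i (π p) • B := fun i hi => by
    rw [hB i (mem_dom_of_mem_finsupport hs hi)]
  rw [average_apply, Finset.sum_congr rfl e, ← Finset.sum_smul,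
    ρ.sum_finsupport _ (Set.mem_univ _), one_smul]

/-- Points over the same base point carry the same weights, so a linear relation between local forms
passes to the averages. -/
theorem map_average {A' : SmoothRightAction V' P' W' G'} {π' : P' → M}
    {s' : ι → LocalGauge U A' π'} (hs : ρ.IsSubordinate fun i => (s i).dom) {p : P} {p' : P'}
    (hp : π' p' = π p) {v : V} {v' : V'} (L : W →L[ℝ] W')
    (hL : ∀ i, π p ∈ (s i).dom → L ((s i).form p v) = (s' i).form p' v') :
    L (average ρ s p v) = average ρ s' p' v' := by
  rw [average_apply, average_apply, hp, map_sum]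
  refine Finset.sum_congr rfl fun i hi => ?_
  rw [map_smul, hL i (mem_dom_of_mem_finsupport hs hi)]

theorem isConnectionForm_average [LieGroup 𝓘(ℝ, W) ∞ G] [IsManifold 𝓘(ℝ, V) ∞ P]
    (h : IsPrincipalBundle U A π)
    (hs : ρ.IsSubordinate fun i => (s i).dom) :
    SmoothRightAction.IsConnectionForm A (average ρ s) where
  contMDiff := by
    have hproj : ContMDiff 𝓘(ℝ, V).tangent 𝓘(ℝ, U) ∞
        (fun x : TangentBundle 𝓘(ℝ, V) P => π x.proj) :=
      h.contMDiff_proj.comp (Bundle.contMDiff_proj (TangentSpace 𝓘(ℝ, V)))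
    have hρ : ∀ i, ContMDiff 𝓘(ℝ, V).tangent 𝓘(ℝ, ℝ) ∞
        (fun x : TangentBundle 𝓘(ℝ, V) P => ρ i (π x.proj)) := fun i =>
      (ρ i).contMDiff.comp hproj
    -- The index set `finsupport` varies with the point; a `finsum` over all indices suits the local
    -- finiteness argument.
    have e : (fun x : TangentBundle 𝓘(ℝ, V) P => average ρ s x.proj x.snd) =
        fun x => ∑ᶠ i, ρ i (π x.proj) • (s i).form x.proj x.snd := by
      funext x
      exact (average_apply ρ s _ _).trans <|
        ρ.sum_finsupport_smul_eq_finsum (π x.proj) fun i _ => (s i).form x.proj x.snd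
    rw [e]
    -- Each term needs checking only on its closed support, which lies over the domain of its gauge,
    -- where the form is smooth.
    refine contMDiff_finsum (fun i => contMDiff_of_tsupport fun x hx => ?_) ?_
    · have hx' : π x.proj ∈ tsupport (ρ i) :=
        closure_minimal (t := (fun x : TangentBundle 𝓘(ℝ, V) P => π x.proj) ⁻¹' tsupport (ρ i))
          (fun y hy => subset_tsupport (ρ i) (left_ne_zero_of_smul hy))
          ((isClosed_tsupport (ρ i)).preimage hproj.continuous) hx
      exact (hρ i x).smul ((s i).contMDiffAt_form h x (hs i hx'))
    · exact (ρ.locallyFinite.preimage_continuous hproj.continuous).subset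
        fun i x hx => left_ne_zero_of_smul hx
  mfderiv_act p g v :=
    (map_average hs (h.proj_act p g) _ fun i hi => ((s i).form_mfderiv_act h hi g v).symm).symm
  fundamental p B := average_eq_of_forall hs fun i hi => (s i).form_fundamental h hi B

end LocalGauge

end ConnectionForm

/-! ### Compatibility of averaged forms and induced maps with equivariant maps. -/

section Naturality

variable {V : Type*} [NormedAddCommGroup V] [NormedSpace ℝ V]
  {P : Type*} [TopologicalSpace P] [ChartedSpace V P]
  {W : Type*} [NormedAddCommGroup W] [NormedSpace ℝ W]
  {G : Type*} [TopologicalSpace G] [ChartedSpace W G] [Group G] [LieGroup 𝓘(ℝ, W) ∞ G]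
  {U : Type*} [NormedAddCommGroup U] [NormedSpace ℝ U]
  {M : Type*} [TopologicalSpace M] [ChartedSpace U M]
  {V' : Type*} [NormedAddCommGroup V'] [NormedSpace ℝ V']
  {P' : Type*} [TopologicalSpace P'] [ChartedSpace V' P']
  {W' : Type*} [NormedAddCommGroup W'] [NormedSpace ℝ W']
  {G' : Type*} [TopologicalSpace G'] [ChartedSpace W' G'] [Group G'] [LieGroup 𝓘(ℝ, W') ∞ G']
  {A : SmoothRightAction V P W G} {A' : SmoothRightAction V' P' W' G'} {π : P → M} {π' : P' → M}

theorem LocalGauge.lieAlgebraMap_average {ι : Type*}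
    {ρ : SmoothPartitionOfUnity ι 𝓘(ℝ, U) M Set.univ}
    {s : ι → LocalGauge U A π} {s' : ι → LocalGauge U A' π'}
    (F : SmoothRightAction.EquivariantMap A A')
    (h : IsPrincipalBundle U A π) (h' : IsPrincipalBundle U A' π')
    (hs : ρ.IsSubordinate fun i => (s i).dom)
    (hF : ∀ p, π' (F.toFun p) = π p) (hdom : ∀ i, (s i).dom ⊆ (s' i).dom)
    (hsec : ∀ i, ∀ x ∈ (s i).dom, F.toFun ((s i).sec x) = (s' i).sec x) (p : P) (v : V) :
    (lieAlgebraMap W W' F.hom : W →L[ℝ] W') (average ρ s p v) =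
      average ρ s' (F.toFun p) ((mfderiv 𝓘(ℝ, V) 𝓘(ℝ, V') F.toFun p : V →L[ℝ] V') v) :=
  map_average (W := W) (W' := W') hs (hF p) (lieAlgebraMap W W' F.hom : W →L[ℝ] W') fun i hi =>
    lieAlgebraMap_form F (s i) (s' i) h h' hF (hdom i) (hsec i) hi v

namespace SmoothRightAction.IsConnectionForm

theorem map_toMap [IsManifold 𝓘(ℝ, V) ∞ P] [IsManifold 𝓘(ℝ, V') ∞ P'] (F : EquivariantMap A A')
    {θ : P → V →L[ℝ] W} {θ' : P' → V' →L[ℝ] W'} (hθ : IsConnectionForm A θ)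
    (hθ' : IsConnectionForm A' θ')
    (hF : ∀ p (v : V), (lieAlgebraMap W W' F.hom : W →L[ℝ] W') (θ p v) =
      θ' (F.toFun p) ((mfderiv 𝓘(ℝ, V) 𝓘(ℝ, V') F.toFun p : V →L[ℝ] V') v)) (a : A.At) :
    Ad.map F (hθ.toMap a) = hθ'.toMap (At.map F a) := by
  obtain ⟨x⟩ := a
  exact congrArg (Ad.mk A' (F.toFun x.proj)) (hF x.proj x.snd)

end SmoothRightAction.IsConnectionForm

end Naturality

/-! ### Assembly of the strict connection. -/

section Main

variable {V₁ : Type*} [NormedAddCommGroup V₁] [NormedSpace ℝ V₁]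
  {E₁ : Type*} [TopologicalSpace E₁] [ChartedSpace V₁ E₁]
  {V₀ : Type*} [NormedAddCommGroup V₀] [NormedSpace ℝ V₀]
  {E₀ : Type*} [TopologicalSpace E₀] [ChartedSpace V₀ E₀]
  {W₁ : Type*} [NormedAddCommGroup W₁] [NormedSpace ℝ W₁]
  {G₁ : Type*} [TopologicalSpace G₁] [ChartedSpace W₁ G₁] [Group G₁] [LieGroup 𝓘(ℝ, W₁) ∞ G₁]
  {W₀ : Type*} [NormedAddCommGroup W₀] [NormedSpace ℝ W₀]
  {G₀ : Type*} [TopologicalSpace G₀] [ChartedSpace W₀ G₀] [Group G₀] [LieGroup 𝓘(ℝ, W₀) ∞ G₀]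
  {U : Type*} [NormedAddCommGroup U] [NormedSpace ℝ U]
  {X : Type*} [TopologicalSpace X] [ChartedSpace U X]
  {𝔾 : LieTwoGroup W₁ G₁ W₀ G₀} {𝔼 : LieGroupoid V₁ E₁ V₀ E₀}
  {𝔓 : PrincipalTwoBundle 𝔾 𝔼 (LieGroupoid.discrete U X)}

namespace PrincipalTwoBundle

/-- The average of the flat connection forms of gauges is multiplicative. -/
theorem Gauge.average_comp {ι : Type*} {ρ : SmoothPartitionOfUnity ι 𝓘(ℝ, U) X Set.univ}
    {s : ι → 𝔓.Gauge} (hs : ρ.IsSubordinate fun i => (s i).objects.dom) {γ₂ γ₁ : E₁}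
    (h : 𝔼.src γ₂ = 𝔼.tgt γ₁) (v₂ v₁ : V₁)
    (hv : (mfderiv 𝓘(ℝ, V₁) 𝓘(ℝ, V₀) 𝔼.src γ₂ : V₁ →L[ℝ] V₀) v₂ =
      (mfderiv 𝓘(ℝ, V₁) 𝓘(ℝ, V₀) 𝔼.tgt γ₁ : V₁ →L[ℝ] V₀) v₁)
    {D : V₁ × V₁ →L[ℝ] V₁}
    (hD : HasMFDerivWithinAt (𝓘(ℝ, V₁).prod 𝓘(ℝ, V₁)) 𝓘(ℝ, V₁)
      (fun q : E₁ × E₁ => 𝔼.comp q.1 q.2) {q : E₁ × E₁ | 𝔼.src q.1 = 𝔼.tgt q.2} (γ₂, γ₁) D) :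
    LocalGauge.average ρ (fun i => (s i).arrows) (𝔼.comp γ₂ γ₁) (D (v₂, v₁)) =
      𝔾.lieComp (LocalGauge.average ρ (fun i => (s i).arrows) γ₂ v₂,
        LocalGauge.average ρ (fun i => (s i).arrows) γ₁ v₁) := by
  simp only [LocalGauge.average_apply]
  -- Both factors and their composite lie over one point of `X`, hence share their weights.
  rw [𝔓.proj₁_comp h, ← 𝔓.proj₁_eq_of_composable h]
  have hsum : ∀ (F : Finset ι) (a b : ι → W₁),
      (∑ i ∈ F, a i, ∑ i ∈ F, b i) = ∑ i ∈ F, (a i, b i) := fun F a b =>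
    Prod.ext (Prod.fst_sum (s := F) (f := fun i => (a i, b i))).symm
      (Prod.snd_sum (s := F) (f := fun i => (a i, b i))).symm
  -- Here `lieComp` must be linear on all pairs of vectors.
  rw [hsum, map_sum]
  refine Finset.sum_congr rfl fun i hi => ?_
  rw [← Prod.smul_mk, map_smul,
    (s i).form_comp h (hs i (subset_tsupport _ ((ρ.mem_finsupport _).1 hi))) v₂ v₁ hv hD]

/-- Connection forms on arrows and objects that are compatible with the structure maps define a
strict connection. -/
theorem isStrictConnection_toMap [IsManifold 𝓘(ℝ, V₁) ∞ E₁] [IsManifold 𝓘(ℝ, V₀) ∞ E₀]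
    {θ₁ : E₁ → V₁ →L[ℝ] W₁} {θ₀ : E₀ → V₀ →L[ℝ] W₀}
    (h₁ : SmoothRightAction.IsConnectionForm 𝔓.action₁ θ₁)
    (h₀ : SmoothRightAction.IsConnectionForm 𝔓.action₀ θ₀)
    (hsrc : ∀ γ (v : V₁), (lieAlgebraMap W₁ W₀ 𝔓.srcMap.hom : W₁ →L[ℝ] W₀) (θ₁ γ v) =
      θ₀ (𝔼.src γ) ((mfderiv 𝓘(ℝ, V₁) 𝓘(ℝ, V₀) 𝔼.src γ : V₁ →L[ℝ] V₀) v))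
    (htgt : ∀ γ (v : V₁), (lieAlgebraMap W₁ W₀ 𝔓.tgtMap.hom : W₁ →L[ℝ] W₀) (θ₁ γ v) =
      θ₀ (𝔼.tgt γ) ((mfderiv 𝓘(ℝ, V₁) 𝓘(ℝ, V₀) 𝔼.tgt γ : V₁ →L[ℝ] V₀) v))
    (hunit : ∀ p (v : V₀), (lieAlgebraMap W₀ W₁ 𝔓.unitMap.hom : W₀ →L[ℝ] W₁) (θ₀ p v) =
      θ₁ (𝔼.unit p) ((mfderiv 𝓘(ℝ, V₀) 𝓘(ℝ, V₁) 𝔼.unit p : V₀ →L[ℝ] V₁) v))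
    (hcomp : ∀ {γ₂ γ₁ : E₁} (_ : 𝔼.src γ₂ = 𝔼.tgt γ₁) (v₂ v₁ : V₁)
      (_ : (mfderiv 𝓘(ℝ, V₁) 𝓘(ℝ, V₀) 𝔼.src γ₂ : V₁ →L[ℝ] V₀) v₂ =
        (mfderiv 𝓘(ℝ, V₁) 𝓘(ℝ, V₀) 𝔼.tgt γ₁ : V₁ →L[ℝ] V₀) v₁) (D : V₁ × V₁ →L[ℝ] V₁)
      (_ : HasMFDerivWithinAt (𝓘(ℝ, V₁).prod 𝓘(ℝ, V₁)) 𝓘(ℝ, V₁)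
        (fun q : E₁ × E₁ => 𝔼.comp q.1 q.2) {q : E₁ × E₁ | 𝔼.src q.1 = 𝔼.tgt q.2} (γ₂, γ₁) D),
      θ₁ (𝔼.comp γ₂ γ₁) (D (v₂, v₁)) = 𝔾.lieComp (θ₁ γ₂ v₂, θ₁ γ₁ v₁)) :
    𝔓.IsStrictConnection h₁.toMap h₀.toMap := by
  refine ⟨⟨h₁.isVectorBundleMap_toMap 𝔓.isPrincipalBundle₁,
    h₀.isVectorBundleMap_toMap 𝔓.isPrincipalBundle₀, h₁.map_toMap 𝔓.srcMap h₀ hsrc,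
    h₁.map_toMap 𝔓.tgtMap h₀ htgt, h₀.map_toMap 𝔓.unitMap h₁ hunit, ?_⟩, h₁.toMap_j, h₀.toMap_j⟩
  rintro _ _ _ ⟨⟨γ₂, v₂⟩, ⟨γ₁, v₁⟩, _, ⟨ht, D, hD, rfl⟩, rfl, rfl, rfl⟩
  have h : 𝔼.src γ₂ = 𝔼.tgt γ₁ := congrArg Bundle.TotalSpace.proj ht
  have hv : (mfderiv 𝓘(ℝ, V₁) 𝓘(ℝ, V₀) 𝔼.src γ₂ : V₁ →L[ℝ] V₀) v₂ =
      (mfderiv 𝓘(ℝ, V₁) 𝓘(ℝ, V₀) 𝔼.tgt γ₁ : V₁ →L[ℝ] V₀) v₁ :=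
    congrArg (fun x : TangentBundle 𝓘(ℝ, V₀) E₀ => (x.snd : V₀)) ht
  -- Compatibility with source and target makes the values of `θ₁` composable in `L(𝔾)`.
  have hK : (lieAlgebraMap W₁ W₀ 𝔾.srcHom : W₁ →L[ℝ] W₀) (θ₁ γ₂ v₂) =
      (lieAlgebraMap W₁ W₀ 𝔾.tgtHom : W₁ →L[ℝ] W₀) (θ₁ γ₁ v₁) :=
    (hsrc γ₂ v₂).trans (Eq.trans (congrArg₂ (fun p (v : V₀) => θ₀ p v) h hv) (htgt γ₁ v₁).symm)
  have key := 𝔾.isTangentComp_lieComp _ _ hK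
  have hc := hcomp h v₂ v₁ hv D hD
  rw [← hc] at key
  exact ⟨γ₂, γ₁, θ₁ γ₂ v₂, θ₁ γ₁ v₁, _, h, key, rfl, rfl, rfl⟩

/-- Every principal 2-bundle over a manifold has a strict connection. -/
theorem exists_isStrictConnection [FiniteDimensional ℝ U] [IsManifold 𝓘(ℝ, U) ∞ X] [T2Space X]
    [SigmaCompactSpace X] [IsManifold 𝓘(ℝ, V₁) ∞ E₁] [IsManifold 𝓘(ℝ, V₀) ∞ E₀]
    (𝔓 : PrincipalTwoBundle 𝔾 𝔼 (LieGroupoid.discrete U X)) :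
    ∃ (R₁ : 𝔓.action₁.At → 𝔓.action₁.Ad) (R₀ : 𝔓.action₀.At → 𝔓.action₀.Ad),
      𝔓.IsStrictConnection R₁ R₀ := by
  choose s hs using 𝔓.exists_gauge_mem
  -- The gauges are indexed by the points of `X`, and this single `ρ` averages the arrow forms and
  -- the object forms.
  obtain ⟨ρ, hρ⟩ := SmoothPartitionOfUnity.exists_isSubordinate 𝓘(ℝ, U) (isClosed_univ (X := X))
    (fun x => (s x).objects.dom) (fun x => (s x).objects.isOpen_dom)
    (fun x _ => Set.mem_iUnion.2 ⟨x, hs x⟩)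
  have hρ₁ : ρ.IsSubordinate fun x => (s x).arrows.dom := fun x => (hρ x).trans (s x).dom_eq.ge
  have hb₁ := 𝔓.isPrincipalBundle₁
  have hb₀ := 𝔓.isPrincipalBundle₀
  have h₁ := LocalGauge.isConnectionForm_average (s := fun x => (s x).arrows) hb₁ hρ₁
  have h₀ := LocalGauge.isConnectionForm_average (s := fun x => (s x).objects) hb₀ hρ
  have hsrc := LocalGauge.lieAlgebraMap_average (s := fun x => (s x).arrows)
    (s' := fun x => (s x).objects) 𝔓.srcMap hb₁ hb₀ hρ₁ 𝔓.proj₀_src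
    (fun i => (s i).dom_eq.le) (fun i x _ => (s i).src_sec x)
  have htgt := LocalGauge.lieAlgebraMap_average (s := fun x => (s x).arrows)
    (s' := fun x => (s x).objects) 𝔓.tgtMap hb₁ hb₀ hρ₁ 𝔓.proj₀_tgt
    (fun i => (s i).dom_eq.le) (fun i x _ => (s i).tgt_sec x)
  have hunit := LocalGauge.lieAlgebraMap_average (s := fun x => (s x).objects)
    (s' := fun x => (s x).arrows) 𝔓.unitMap hb₀ hb₁ hρ 𝔓.proj₁_unit
    (fun i => (s i).dom_eq.ge) (fun i x _ => ((s i).sec_eq x).symm)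
  exact ⟨_, _, isStrictConnection_toMap h₁ h₀ hsrc htgt hunit
    fun h v₂ v₁ hv D hD => Gauge.average_comp hρ h v₂ v₁ hv hD⟩

end PrincipalTwoBundle

end Main

end PrincipalTwo

theorem mainTheorem7
    {V₁ : Type*} [NormedAddCommGroup V₁] [NormedSpace ℝ V₁] [FiniteDimensional ℝ V₁]
    {E₁ : Type*} [TopologicalSpace E₁] [ChartedSpace V₁ E₁] [IsManifold 𝓘(ℝ, V₁) ∞ E₁]
    [T2Space E₁] [SecondCountableTopology E₁]
    {V₀ : Type*} [NormedAddCommGroup V₀] [NormedSpace ℝ V₀] [FiniteDimensional ℝ V₀]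
    {E₀ : Type*} [TopologicalSpace E₀] [ChartedSpace V₀ E₀] [IsManifold 𝓘(ℝ, V₀) ∞ E₀]
    [T2Space E₀] [SecondCountableTopology E₀]
    {W₁ : Type*} [NormedAddCommGroup W₁] [NormedSpace ℝ W₁] [FiniteDimensional ℝ W₁]
    {G₁ : Type*} [TopologicalSpace G₁] [ChartedSpace W₁ G₁] [Group G₁] [LieGroup 𝓘(ℝ, W₁) ∞ G₁]
    [T2Space G₁] [SecondCountableTopology G₁]
    {W₀ : Type*} [NormedAddCommGroup W₀] [NormedSpace ℝ W₀] [FiniteDimensional ℝ W₀]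
    {G₀ : Type*} [TopologicalSpace G₀] [ChartedSpace W₀ G₀] [Group G₀] [LieGroup 𝓘(ℝ, W₀) ∞ G₀]
    [T2Space G₀] [SecondCountableTopology G₀]
    {U : Type*} [NormedAddCommGroup U] [NormedSpace ℝ U] [FiniteDimensional ℝ U]
    {X : Type*} [TopologicalSpace X] [ChartedSpace U X] [IsManifold 𝓘(ℝ, U) ∞ X]
    [T2Space X] [SecondCountableTopology X]
    (𝔾 : PrincipalTwo.LieTwoGroup W₁ G₁ W₀ G₀) (𝔼 : PrincipalTwo.LieGroupoid V₁ E₁ V₀ E₀)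
    (𝔓 : PrincipalTwo.PrincipalTwoBundle 𝔾 𝔼 (PrincipalTwo.LieGroupoid.discrete U X)) :
    ∃ (R₁ : 𝔓.action₁.At → 𝔓.action₁.Ad) (R₀ : 𝔓.action₀.At → 𝔓.action₀.Ad),
      𝔓.IsStrictConnection R₁ R₀ := by
  -- With second countability this yields the σ-compactness required for partitions of unity.
  have : LocallyCompactSpace X := ChartedSpace.locallyCompactSpace U X
  exact 𝔓.exists_isStrictConnection
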